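/- Let $M,N\ge 2$ be even and consider the pyrochlore checkerboard with periodic boundary conditions: the sites are the $\Lambda=MN$ points of $\mathbb Z/M\times\mathbb Z/N$, and the boxes are the squares $x=\{(i,j),(i+1,j),(i,j+1),(i+1,j+1)\}$ with $i+j$ even (so there are $\Lambda/2$ boxes and every site lies in exactly two of them). Each site carries a spin $s\in\{0,\tfrac12,1,\tfrac32,\dots\}$ with spin operators $\mathbf s=(s^{(1)},s^{(2)},s^{(3)})$ in the $(2s+1)$-dimensional irreducible representation. For a box $x$ let $S^{(a)}_x=(s_1^{(a)}+s_2^{(a)}+s_3^{(a)}+s_4^{(a)})_x$ be the sum over its four sites, and let $S^{(3)}_{\rm tot}$ be the sum of $s^{(3)}$ over all sites. For real fields $\{b_x\}$ on the boxes put $$H_{\{b_x\}}=\frac12\sum_x\Big[(S^{(1)}_x)^2+(S^{(2)}_x)^2+(S^{(3)}_x-b_x)^2\Big],\qquad H_0=H_{\{0\}},$$ let $E_{\{b_x\}}$ be the smallest eigenvalue of $H_{\{b_x\}}$ and, for $\beta>0$, $Z_{\{b_x\}}=\operatorname{tr}e^{-\beta H_{\{b_x\}}}$; $E_0$, $Z_0$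 are the values at $b_x\equiv0$. Then: 1. $E_{\{b_x\}}\ge E_0$ for all real $\{b_x\}$. 2. $Z_{\{b_x\}}\le Z_0$ for all $\beta>0$ and all real $\{b_x\}$. 3. Every ground state $\psi$ of $H_0$ satisfies $\langle\psi|S^{(3)}_{\rm tot}|\psi\rangle=0$ and $\langle\psi|S^{(3)}_x|\psi\rangle=0$ for every box $x$. 4. (Homogeneous field.) Let $E(B)$ be the smallest eigenvalue of $H_0-BS^{(3)}_{\rm tot}$ and, for $\beta>0$, let $F(B)=-\beta^{-1}\ln\operatorname{tr}e^{-\beta(H_0-BS^{(3)}_{\rm tot})}$. Then, for all real $B$, $$E(B)+\frac{\Lambda}{16}B^2\ge E(0),\qquad F(B)+\frac{\Lambda}{16}B^2\ge F(0).$$ Both $E$ and $F$ are twice continuously differentiable at $B=0$; the magnetization per site at zero field vanishes and the susceptibility per site at zero field is at most $\frac18$, i.e. for $G=E$ and for $G=F$ (every $\beta>0$) $$-\frac1\Lambda G'(0)=0,\qquad -\frac1\Lambda G''(0)\le\frac18 .$$ 5. (Field on a single box.) Fix a box $x$, let $E(b)$ be the smallest eigenvalue of $H_0-bS^{(3)}_x$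 and, for $\beta>0$, let $F(b)=-\beta^{-1}\ln\operatorname{tr}e^{-\beta(H_0-bS^{(3)}_x)}$. Then $E(b)+\frac12b^2\ge E(0)$ and $F(b)+\frac12b^2\ge F(0)$ for all real $b$, $E'(0)=0$ and $F'(0)=0$, $F$ is twice continuously differentiable at $0$ with $-\frac14F''(0)\le\frac14$, and, if $E$ is differentiable near $0$ and twice differentiable at $0$, also $-\frac14E''(0)\le\frac14$. -/

import Mathlib

open Matrix Topology

namespace Pyrochlore

noncomputable section

/-! ### Spin operators of a single site

The spin is `s = d / 2` with `d : ℕ`; the basis vector with index `k : Fin (d + 1)` is the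
eigenvector `|s, m⟩` of the third spin component with `m = s - k`. -/

/-- Raising operator: `S⁺ |s, m⟩ = √((s - m) (s + m + 1)) |s, m + 1⟩`; in terms of `k = s - m`
the coefficient is `√(k (d + 1 - k))` and `m + 1` has index `k - 1`. -/
def spinRaise (d : ℕ) : Matrix (Fin (d + 1)) (Fin (d + 1)) ℂ :=
  fun l k => if (l : ℕ) + 1 = (k : ℕ) then ((Real.sqrt ((k : ℝ) * ((d : ℝ) + 1 - (k : ℝ))) : ℝ) : ℂ) else 0

/-- First spin component `(S⁺ + S⁻) / 2`. -/
def spin1 (d : ℕ) : Matrix (Fin (d + 1)) (Fin (d + 1)) ℂ :=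
  (1 / 2 : ℂ) • (spinRaise d + (spinRaise d)ᴴ)

/-- Second spin component `(S⁺ - S⁻) / (2 i)`. -/
def spin2 (d : ℕ) : Matrix (Fin (d + 1)) (Fin (d + 1)) ℂ :=
  (1 / (2 * Complex.I) : ℂ) • (spinRaise d - (spinRaise d)ᴴ)

/-- Third spin component, diagonal with entries `m = s - k`. -/
def spin3 (d : ℕ) : Matrix (Fin (d + 1)) (Fin (d + 1)) ℂ :=
  Matrix.diagonal fun k => (d : ℂ) / 2 - ((k : ℕ) : ℂ)

/-! ### The periodic pyrochlore checkerboard -/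

/-- Sites of the `M × N` square lattice with periodic boundary conditions. -/
abbrev Site (M N : ℕ) : Type := ZMod M × ZMod N

/-- The boxes (frustrated units): every other square of the lattice, labelled by the lower left
corner `(i, j)` with `i + j` even. For even `M` and `N` this is the checkerboard pattern on the
torus. -/
abbrev Box (M N : ℕ) : Type := {p : Site M N // Even (p.1.val + p.2.val)}

/-- Basis configurations of the spin system: an `S³` eigenstate on each site. Operators of the
spin system are matrices indexed by configurations. -/
abbrev Config (M N d : ℕ) : Type := Site M N → Fin (d + 1)

variable {M N : ℕ} [NeZero M] [NeZero N]

/-- The one-site operator `A` acting on site `i`, i.e. `A` on the tensor factor of `i` and the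
identity on all other tensor factors. -/
def siteOp {d : ℕ} (A : Matrix (Fin (d + 1)) (Fin (d + 1)) ℂ) (i : Site M N) :
    Matrix (Config M N d) (Config M N d) ℂ :=
  fun σ τ => if ∀ j, j ≠ i → σ j = τ j then A (σ i) (τ i) else 0

/-- The sum of the one-site operator `A` over the four sites of the box `x`. -/
def boxOp {d : ℕ} (A : Matrix (Fin (d + 1)) (Fin (d + 1)) ℂ) (x : Box M N) :
    Matrix (Config M N d) (Config M N d) ℂ :=
  siteOp A (x.1.1, x.1.2) + siteOp A (x.1.1 + 1, x.1.2) +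
    siteOp A (x.1.1, x.1.2 + 1) + siteOp A (x.1.1 + 1, x.1.2 + 1)

/-- The sum of the one-site operator `A` over all sites. -/
def totalOp (M N : ℕ) [NeZero M] [NeZero N] {d : ℕ}
    (A : Matrix (Fin (d + 1)) (Fin (d + 1)) ℂ) :
    Matrix (Config M N d) (Config M N d) ℂ :=
  ∑ i : Site M N, siteOp A i

/-- The Heisenberg hamiltonian of the periodic checkerboard with fields `b x` on the boxes:
half the sum over the boxes of the squared total spin of the box, with the third component
`S³` of box `x` replaced by `S³ - b x`. -/
def hamiltonian (d : ℕ) (b : Box M N → ℝ) : Matrix (Config M N d) (Config M N d) ℂ :=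
  (1 / 2 : ℂ) • ∑ x : Box M N,
    (boxOp (spin1 d) x ^ 2 + boxOp (spin2 d) x ^ 2 +
      (boxOp (spin3 d) x - ((b x : ℝ) : ℂ) • (1 : Matrix (Config M N d) (Config M N d) ℂ)) ^ 2)

/-- The hamiltonian `H₀` without field. -/
def hamiltonian₀ (M N : ℕ) [NeZero M] [NeZero N] (d : ℕ) :
    Matrix (Config M N d) (Config M N d) ℂ :=
  hamiltonian d (0 : Box M N → ℝ)

/-- `H₀ - B S³_tot`: all spins in a homogeneous external field `B`. -/
def homogeneousField (M N : ℕ) [NeZero M] [NeZero N] (d : ℕ) (B : ℝ) :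
    Matrix (Config M N d) (Config M N d) ℂ :=
  hamiltonian₀ M N d - (B : ℂ) • totalOp M N (spin3 d)

/-- `H₀ - b S³_box`: the single box `x` in an external field `b`. -/
def singleBoxField (d : ℕ) (x : Box M N) (b : ℝ) :
    Matrix (Config M N d) (Config M N d) ℂ :=
  hamiltonian₀ M N d - (b : ℂ) • boxOp (spin3 d) x

/-! ### Ground states and thermodynamics -/

/-- The ground-state energy: the smallest (real) eigenvalue. -/
def groundEnergy {ι : Type*} [Fintype ι] [DecidableEq ι] (H : Matrix ι ι ℂ) : ℝ :=
  sInf {e : ℝ | Module.End.HasEigenvalue (Matrix.toLin' H) (e : ℂ)}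

/-- A (not necessarily normalized) ground state. -/
def IsGroundState {ι : Type*} [Fintype ι] [DecidableEq ι] (H : Matrix ι ι ℂ) (ψ : ι → ℂ) : Prop :=
  ψ ≠ 0 ∧ H *ᵥ ψ = (groundEnergy H : ℂ) • ψ

/-- The partition function `tr exp (-β H)` (a real number for Hermitian `H`). -/
def partitionFunction {ι : Type*} [Fintype ι] [DecidableEq ι] (β : ℝ) (H : Matrix ι ι ℂ) : ℝ :=
  (Matrix.trace (NormedSpace.exp (-(β : ℂ) • H))).re

/-- The free energy `-β⁻¹ log tr exp (-β H)`. -/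
def freeEnergy {ι : Type*} [Fintype ι] [DecidableEq ι] (β : ℝ) (H : Matrix ι ι ℂ) : ℝ :=
  -β⁻¹ * Real.log (partitionFunction β H)

end

end Pyrochlore

open Pyrochlore

/-! The proof rests on reflection positivity. Cut the torus between the columns `c` and `c + 1` and
at the opposite place, and rotate the spins of one half by π about the second axis. Every spin
component `A` there turns into `-conj A`, so a box operator folds to `T ⊗ 1 - 1 ⊗ conj T'`, with `T'
= T` for a box cut by the reflection. In `-β H` the cross terms of the cut boxes have the form `C ⊗
conj D` with positive sign, those of the other boxes vanish, and the Cauchy–Schwarz inequality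
`norm_trace_exp_sq_le` yields `Z(b)² ≤ Z(b₁) Z(b₂)` (`partitionFunction_hamiltonian_sq_le`). The
fields `b₁` and `b₂` keep `b` on one half, carry minus its mirror image on the other, and vanish on
the cut boxes.

Hence zero field maximizes `Z` (`partitionFunction_hamiltonian_le`): among the finitely many fields
with values in `{0, ±b x}` take a maximizer with the most zeros. If it were nonzero on some box,
reflecting through the middle of that box would give two maximizers, one of them with more zeros.
Letting `β → ∞` gives the statement for ground energies.

Expanding the squares turns this into quadratic lower bounds for energies in a homogeneous or
single-box field. A nonzero magnetization of a ground state would lower the energy to first order in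
the field, against these bounds; the second-order condition at a minimum bounds the
susceptibilities. In a homogeneous field the total magnetization is conserved and vanishes in all
ground states, so by the spectral gap the ground energy is constant near `B = 0`
(`eventually_groundEnergy_eq`). -/

namespace Pyrochlore

noncomputable section

/-! ### A Cauchy–Schwarz inequality for traces of exponentials -/

section Trace

open scoped Kronecker Matrix.Norms.Operator

variable {n : Type} [Fintype n] [DecidableEq n]

/-- Entrywise complex conjugation of matrices. -/
abbrev conjMat : Matrix n n ℂ →+* Matrix n n ℂ := (starRingEnd ℂ).mapMatrix

/-- The operators `∑ X i ⊗ conj (Y i)`, `∑ X i ⊗ conj (X i)`, `∑ Y i ⊗ conj (Y i)` with common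
families `X` and `Y`. -/
def IsPairing (P Q R : Matrix (n × n) (n × n) ℂ) : Prop :=
  ∃ (κ : Type) (_ : Fintype κ) (X Y : κ → Matrix n n ℂ),
    P = ∑ i, X i ⊗ₖ conjMat (Y i) ∧ Q = ∑ i, X i ⊗ₖ conjMat (X i) ∧
      R = ∑ i, Y i ⊗ₖ conjMat (Y i)

lemma IsPairing.single (X Y : Matrix n n ℂ) :
    IsPairing (X ⊗ₖ conjMat Y) (X ⊗ₖ conjMat X) (Y ⊗ₖ conjMat Y) :=
  ⟨Unit, inferInstance, fun _ => X, fun _ => Y, by simp, by simp, by simp⟩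

lemma IsPairing.zero : IsPairing (0 : Matrix (n × n) (n × n) ℂ) 0 0 :=
  ⟨Empty, inferInstance, Empty.elim, Empty.elim, by simp, by simp, by simp⟩

lemma IsPairing.one : IsPairing (1 : Matrix (n × n) (n × n) ℂ) 1 1 := by
  simpa using IsPairing.single (1 : Matrix n n ℂ) 1

lemma IsPairing.add {P Q R P' Q' R' : Matrix (n × n) (n × n) ℂ}
    (h : IsPairing P Q R) (h' : IsPairing P' Q' R') :
    IsPairing (P + P') (Q + Q') (R + R') := by
  obtain ⟨κ, _, X, Y, rfl, rfl, rfl⟩ := h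
  obtain ⟨κ', _, X', Y', rfl, rfl, rfl⟩ := h'
  exact ⟨κ ⊕ κ', inferInstance, Sum.elim X X', Sum.elim Y Y', by simp, by simp, by simp⟩

/-- Entrywise conjugation, unlike the adjoint, keeps the order of products; this is why it is the
operation on the second factor. -/
lemma IsPairing.mul {P Q R P' Q' R' : Matrix (n × n) (n × n) ℂ}
    (h : IsPairing P Q R) (h' : IsPairing P' Q' R') :
    IsPairing (P * P') (Q * Q') (R * R') := by
  obtain ⟨κ, _, X, Y, rfl, rfl, rfl⟩ := h
  obtain ⟨κ', _, X', Y', rfl, rfl, rfl⟩ := h'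
  refine ⟨κ × κ', inferInstance, fun p => X p.1 * X' p.2, fun p => Y p.1 * Y' p.2, ?_, ?_, ?_⟩ <;>
  simp only [Fintype.sum_mul_sum, Fintype.sum_prod_type, map_mul, ← Matrix.mul_kronecker_mul]

/-- The scalar is shared as `√c` between both factors, hence the sign condition. -/
lemma IsPairing.smul {P Q R : Matrix (n × n) (n × n) ℂ} (h : IsPairing P Q R) {c : ℝ}
    (hc : 0 ≤ c) : IsPairing ((c : ℂ) • P) ((c : ℂ) • Q) ((c : ℂ) • R) := by
  obtain ⟨κ, _, X, Y, rfl, rfl, rfl⟩ := h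
  have hs : ((Real.sqrt c : ℝ) : ℂ) * ((Real.sqrt c : ℝ) : ℂ) = c := by
    rw [← Complex.ofReal_mul, Real.mul_self_sqrt hc]
  have hm : ∀ Z : Matrix n n ℂ,
      conjMat (((Real.sqrt c : ℝ) : ℂ) • Z) = ((Real.sqrt c : ℝ) : ℂ) • conjMat Z := by
    intro Z
    ext i j
    simp
  refine ⟨κ, inferInstance, fun i => ((Real.sqrt c : ℝ) : ℂ) • X i,
    fun i => ((Real.sqrt c : ℝ) : ℂ) • Y i, ?_, ?_, ?_⟩ <;>
  simp only [hm, Matrix.smul_kronecker, Matrix.kronecker_smul, smul_smul, hs, Finset.smul_sum]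

lemma IsPairing.sum {ι : Type*} (s : Finset ι) {P Q R : ι → Matrix (n × n) (n × n) ℂ}
    (h : ∀ i, IsPairing (P i) (Q i) (R i)) :
    IsPairing (∑ i ∈ s, P i) (∑ i ∈ s, Q i) (∑ i ∈ s, R i) := by
  classical
  induction s using Finset.induction_on with
  | empty => simpa using IsPairing.zero
  | insert a s ha ih => simpa only [Finset.sum_insert ha] using (h a).add ih

lemma IsPairing.pow {P Q R : Matrix (n × n) (n × n) ℂ} (h : IsPairing P Q R) (k : ℕ) :
    IsPairing (P ^ k) (Q ^ k) (R ^ k) := by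
  induction k with
  | zero => simpa using IsPairing.one
  | succ k ih => simpa only [pow_succ] using ih.mul h

/-- Since `tr (X ⊗ conj Y) = tr X · conj (tr Y)`, this is Cauchy–Schwarz for the vectors of traces
of the `X i` and the `Y i`. -/
lemma IsPairing.norm_trace_sq_le {P Q R : Matrix (n × n) (n × n) ℂ} (h : IsPairing P Q R) :
    ‖P.trace‖ ^ 2 ≤ Q.trace.re * R.trace.re := by
  obtain ⟨κ, _, X, Y, rfl, rfl, rfl⟩ := h
  have ht : ∀ Z : Matrix n n ℂ, (conjMat Z).trace = star Z.trace := by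
    intro Z
    simp [Matrix.trace]
  have hq : ∀ Z : κ → Matrix n n ℂ,
      (∑ i, Z i ⊗ₖ conjMat (Z i)).trace.re = ∑ i, ‖(Z i).trace‖ ^ 2 := by
    intro Z
    simp only [Matrix.trace_sum, Matrix.trace_kronecker, ht, Complex.re_sum]
    refine Finset.sum_congr rfl fun i _ => ?_
    rw [Complex.star_def, Complex.mul_conj, Complex.ofReal_re, Complex.normSq_eq_norm_sq]
  rw [hq, hq]
  simp only [Matrix.trace_sum, Matrix.trace_kronecker, ht]
  refine le_trans ?_ (Finset.sum_mul_sq_le_sq_mul_sq Finset.univ _ _)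
  gcongr
  refine (norm_sum_le _ _).trans (le_of_eq ?_)
  simp

/-- The exponential series has nonnegative coefficients, so its partial sums are again pairings, and
the inequality survives the limit. -/
lemma IsPairing.norm_trace_exp_sq_le {P Q R : Matrix (n × n) (n × n) ℂ} (h : IsPairing P Q R) :
    ‖(NormedSpace.exp P).trace‖ ^ 2 ≤
      (NormedSpace.exp Q).trace.re * (NormedSpace.exp R).trace.re := by
  have hs : ∀ A : Matrix (n × n) (n × n) ℂ, Filter.Tendsto
      (fun m : ℕ => (∑ k ∈ Finset.range m, (((k.factorial : ℝ)⁻¹ : ℝ) : ℂ) • A ^ k).trace)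
      Filter.atTop (𝓝 (NormedSpace.exp A).trace) := by
    intro A
    have := (NormedSpace.exp_series_hasSum_exp' (𝕂 := ℂ) A).tendsto_sum_nat
    have hc : Continuous (Matrix.trace : Matrix (n × n) (n × n) ℂ → ℂ) :=
      Continuous.matrix_trace continuous_id
    refine ((hc.tendsto _).comp this).congr fun m => ?_
    simp only [Function.comp_apply]
    congr 1
    refine Finset.sum_congr rfl fun k _ => ?_
    rw [Complex.ofReal_inv, Complex.ofReal_natCast]
  refine le_of_tendsto_of_tendsto' ((hs P).norm.pow 2)
    (((Complex.continuous_re.tendsto _).comp (hs Q)).mul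
      ((Complex.continuous_re.tendsto _).comp (hs R))) fun m => ?_
  exact (IsPairing.sum _ fun k => (h.pow k).smul (by positivity)).norm_trace_sq_le

/-- The trace inequality of Dyson, Lieb and Simon. -/
lemma norm_trace_exp_sq_le {κ : Type*} [Fintype κ] (A B : Matrix n n ℂ) (C D : κ → Matrix n n ℂ) :
    ‖(NormedSpace.exp (A ⊗ₖ 1 + 1 ⊗ₖ conjMat B + ∑ i, C i ⊗ₖ conjMat (D i))).trace‖ ^ 2 ≤
      (NormedSpace.exp (A ⊗ₖ 1 + 1 ⊗ₖ conjMat A + ∑ i, C i ⊗ₖ conjMat (C i))).trace.re *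
      (NormedSpace.exp (B ⊗ₖ 1 + 1 ⊗ₖ conjMat B + ∑ i, D i ⊗ₖ conjMat (D i))).trace.re := by
  set K : Matrix n n ℂ → Matrix n n ℂ → (κ → Matrix n n ℂ) → (κ → Matrix n n ℂ) →
      Matrix (n × n) (n × n) ℂ :=
    fun A B C D => A ⊗ₖ 1 + 1 ⊗ₖ conjMat B + ∑ i, C i ⊗ₖ conjMat (D i) with hK
  -- `A ⊗ 1 + 1 ⊗ conj B` alone is not of the form needed for a pairing. The product `(tA + t⁻¹) ⊗
  -- conj (tB + t⁻¹)` is, and differs from it by an error of order `t²` and the scalar `t⁻²`; the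
  -- scalar contributes the same factor to both sides of the inequality, and the error vanishes as
  -- `t → 0`.
  set S : ℝ → Matrix n n ℂ → Matrix n n ℂ := fun t X => (t : ℂ) • X + ((t⁻¹ : ℝ) : ℂ) • 1 with hS
  have key : ∀ (A B : Matrix n n ℂ) (C D : κ → Matrix n n ℂ) (t : ℝ), 0 < t →
      S t A ⊗ₖ conjMat (S t B) + ∑ i, C i ⊗ₖ conjMat (D i) =
        (K A B C D + ((t ^ 2 : ℝ) : ℂ) • (A ⊗ₖ conjMat B)) + ((t⁻¹ ^ 2 : ℝ) : ℂ) • 1 := by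
    intro A B C D t ht
    have h1 : conjMat (S t B) = (t : ℂ) • conjMat B + ((t⁻¹ : ℝ) : ℂ) • 1 := by
      ext i j
      by_cases hij : i = j <;> simp [hS, hij]
    have ht' : (t : ℂ) * ((t⁻¹ : ℝ) : ℂ) = 1 := by
      rw [← Complex.ofReal_mul, mul_inv_cancel₀ ht.ne', Complex.ofReal_one]
    have ht'' : ((t⁻¹ : ℝ) : ℂ) * (t : ℂ) = 1 := by rw [mul_comm, ht']
    rw [h1, hS, hK]
    simp only [Matrix.add_kronecker, Matrix.kronecker_add, Matrix.smul_kronecker,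
      Matrix.kronecker_smul, Matrix.one_kronecker_one, smul_add, smul_smul, ht', ht'', one_smul]
    rw [← Complex.ofReal_mul, ← Complex.ofReal_mul, ← pow_two, ← pow_two]
    abel
  have main : ∀ t : ℝ, 0 < t →
      ‖(NormedSpace.exp (K A B C D + ((t ^ 2 : ℝ) : ℂ) • (A ⊗ₖ conjMat B))).trace‖ ^ 2 ≤
      (NormedSpace.exp (K A A C C + ((t ^ 2 : ℝ) : ℂ) • (A ⊗ₖ conjMat A))).trace.re *
      (NormedSpace.exp (K B B D D + ((t ^ 2 : ℝ) : ℂ) • (B ⊗ₖ conjMat B))).trace.re := by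
    intro t ht
    have h := ((IsPairing.single (S t A) (S t B)).add
      (IsPairing.sum Finset.univ fun i => IsPairing.single (C i) (D i))).norm_trace_exp_sq_le
    rw [key A B C D t ht, key A A C C t ht, key B B D D t ht] at h
    have he : ∀ X : Matrix (n × n) (n × n) ℂ,
        (NormedSpace.exp (X + ((t⁻¹ ^ 2 : ℝ) : ℂ) • 1)).trace =
          ((Real.exp (t⁻¹ ^ 2) : ℝ) : ℂ) * (NormedSpace.exp X).trace := by
      intro X
      rw [Matrix.exp_add_of_commute _ _ ((Commute.one_right X).smul_right _)]
      have : NormedSpace.exp (((t⁻¹ ^ 2 : ℝ) : ℂ) • (1 : Matrix (n × n) (n × n) ℂ)) =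
          ((Real.exp (t⁻¹ ^ 2) : ℝ) : ℂ) • 1 := by
        rw [Matrix.smul_one_eq_diagonal, Matrix.exp_diagonal, Matrix.smul_one_eq_diagonal]
        congr 1
        ext i
        rw [Pi.coe_exp, ← Complex.exp_eq_exp_ℂ, Complex.ofReal_exp]
      rw [this, Matrix.mul_smul, Matrix.mul_one, Matrix.trace_smul, smul_eq_mul]
    rw [he, he, he, norm_mul, mul_pow, Complex.re_ofReal_mul, Complex.re_ofReal_mul,
      Complex.norm_real, Real.norm_eq_abs, sq_abs] at h
    have hp := Real.exp_pos (t⁻¹ ^ 2)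
    have hp2 : 0 < Real.exp (t⁻¹ ^ 2) ^ 2 := by positivity
    refine le_of_mul_le_mul_left ?_ hp2
    linarith
  have lim : ∀ (X Y : Matrix (n × n) (n × n) ℂ), Filter.Tendsto
      (fun t : ℝ => (NormedSpace.exp (X + ((t ^ 2 : ℝ) : ℂ) • Y)).trace) (𝓝[>] 0)
      (𝓝 (NormedSpace.exp X).trace) := by
    intro X Y
    have hc : Continuous fun t : ℝ => (NormedSpace.exp (X + ((t ^ 2 : ℝ) : ℂ) • Y)).trace := by
      refine Continuous.matrix_trace (NormedSpace.exp_continuous.comp ?_)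
      fun_prop
    have := hc.tendsto 0
    simp only [ne_eq, OfNat.ofNat_ne_zero, not_false_eq_true, zero_pow, Complex.ofReal_zero,
      zero_smul, add_zero] at this
    exact this.mono_left nhdsWithin_le_nhds
  refine le_of_tendsto_of_tendsto ((lim _ (A ⊗ₖ conjMat B)).norm.pow 2)
    (((Complex.continuous_re.tendsto _).comp (lim _ (A ⊗ₖ conjMat A))).mul
      ((Complex.continuous_re.tendsto _).comp (lim _ (B ⊗ₖ conjMat B)))) ?_
  filter_upwards [self_mem_nhdsWithin] with t ht
  exact main t ht

end Trace

/-! ### Ground energies and partition functions of Hermitian matrices -/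

section Hermitian

open scoped ComplexOrder

variable {ι : Type*} [Fintype ι] [DecidableEq ι] {H : Matrix ι ι ℂ}

lemma hasEigenvalue_toLin'_iff (e : ℂ) :
    Module.End.HasEigenvalue (Matrix.toLin' H) e ↔ ∃ ψ : ι → ℂ, ψ ≠ 0 ∧ H *ᵥ ψ = e • ψ := by
  constructor
  · intro h
    obtain ⟨v, hv⟩ := h.exists_hasEigenvector
    exact ⟨v, hv.2, by simpa using hv.apply_eq_smul⟩
  · rintro ⟨ψ, h0, h⟩
    exact Module.End.hasEigenvalue_of_hasEigenvector
      ⟨Module.End.mem_eigenspace_iff.2 (by simpa using h), h0⟩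

lemma setOf_hasEigenvalue_eq_range (hH : H.IsHermitian) :
    {e : ℝ | Module.End.HasEigenvalue (Matrix.toLin' H) (e : ℂ)} = Set.range hH.eigenvalues := by
  ext e
  rw [Set.mem_ofPred_eq, Module.End.hasEigenvalue_iff_mem_spectrum, Matrix.spectrum_toLin',
    hH.spectrum_eq_image_range]
  constructor
  · rintro ⟨_, ⟨i, rfl⟩, h⟩
    exact ⟨i, by simpa using h⟩
  · rintro ⟨i, rfl⟩
    exact ⟨_, ⟨i, rfl⟩, rfl⟩

lemma groundEnergy_le_eigenvalues (hH : H.IsHermitian) (i : ι) :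
    groundEnergy H ≤ hH.eigenvalues i := by
  rw [groundEnergy, setOf_hasEigenvalue_eq_range hH]
  exact csInf_le (Set.finite_range _).bddBelow ⟨i, rfl⟩

lemma exists_eigenvalues_eq_groundEnergy [Nonempty ι] (hH : H.IsHermitian) :
    ∃ i, hH.eigenvalues i = groundEnergy H := by
  rw [groundEnergy, setOf_hasEigenvalue_eq_range hH]
  exact (Set.range_nonempty hH.eigenvalues).csInf_mem (Set.finite_range _)

lemma groundEnergy_le_of_mulVec_eq (hH : H.IsHermitian) {e : ℝ} {ψ : ι → ℂ} (hψ : ψ ≠ 0)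
    (h : H *ᵥ ψ = (e : ℂ) • ψ) : groundEnergy H ≤ e := by
  have he : e ∈ Set.range hH.eigenvalues := by
    rw [← setOf_hasEigenvalue_eq_range hH]
    exact (hasEigenvalue_toLin'_iff _).2 ⟨ψ, hψ, h⟩
  obtain ⟨i, rfl⟩ := he
  exact groundEnergy_le_eigenvalues hH i

lemma exists_isGroundState [Nonempty ι] (hH : H.IsHermitian) : ∃ ψ, IsGroundState H ψ := by
  obtain ⟨i, hi⟩ := exists_eigenvalues_eq_groundEnergy hH
  have : groundEnergy H ∈ {e : ℝ | Module.End.HasEigenvalue (Matrix.toLin' H) (e : ℂ)} := by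
    rw [setOf_hasEigenvalue_eq_range hH]
    exact ⟨i, hi⟩
  exact (hasEigenvalue_toLin'_iff _).1 this

/-- The spectrum of a Hermitian matrix has a gap above the ground energy. -/
lemma exists_gap (hH : H.IsHermitian) : ∃ δ : ℝ, 0 < δ ∧ ∀ (e : ℝ) (ψ : ι → ℂ), ψ ≠ 0 →
    H *ᵥ ψ = (e : ℂ) • ψ → e = groundEnergy H ∨ groundEnergy H + δ ≤ e := by
  have hfin : (Set.range hH.eigenvalues \ {groundEnergy H}).Finite :=
    (Set.finite_range _).subset Set.sdiff_subset
  have : ∀ᶠ δ : ℝ in 𝓝[>] 0, ∀ e ∈ Set.range hH.eigenvalues \ {groundEnergy H},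
      groundEnergy H + δ ≤ e := by
    rw [Filter.eventually_all_finite hfin]
    rintro e ⟨⟨i, rfl⟩, hne⟩
    have hlt : 0 < hH.eigenvalues i - groundEnergy H :=
      sub_pos.2 (lt_of_le_of_ne (groundEnergy_le_eigenvalues hH i) (Ne.symm hne))
    filter_upwards [mem_nhdsWithin_of_mem_nhds (Iio_mem_nhds hlt)] with δ hδ
    have : δ < hH.eigenvalues i - groundEnergy H := hδ
    linarith
  obtain ⟨δ, hδ, hpos⟩ := (this.and self_mem_nhdsWithin).exists
  refine ⟨δ, hpos, fun e ψ h0 h => ?_⟩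
  by_cases he : e = groundEnergy H
  · exact Or.inl he
  · refine Or.inr (hδ e ⟨?_, he⟩)
    rw [← setOf_hasEigenvalue_eq_range hH]
    exact (hasEigenvalue_toLin'_iff _).2 ⟨ψ, h0, h⟩

/-- The variational principle. -/
lemma groundEnergy_mul_le (hH : H.IsHermitian) (ψ : ι → ℂ) :
    groundEnergy H * (star ψ ⬝ᵥ ψ).re ≤ (star ψ ⬝ᵥ (H *ᵥ ψ)).re := by
  have hK : (H - (groundEnergy H : ℂ) • 1).IsHermitian := by
    refine hH.sub ?_
    rw [Matrix.IsHermitian, Matrix.conjTranspose_smul]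
    simp
  have hp : (H - (groundEnergy H : ℂ) • 1).PosSemidef := by
    rw [hK.posSemidef_iff_eigenvalues_nonneg]
    intro i
    have hv := hK.mulVec_eigenvectorBasis i
    have hne : (hK.eigenvectorBasis i).ofLp ≠ 0 :=
      (WithLp.ofLp_eq_zero 2).ne.2 (hK.eigenvectorBasis.orthonormal.ne_zero i)
    have : H *ᵥ (hK.eigenvectorBasis i).ofLp =
        ((hK.eigenvalues i + groundEnergy H : ℝ) : ℂ) • (hK.eigenvectorBasis i).ofLp := by
      rw [Matrix.sub_mulVec, Matrix.smul_mulVec, Matrix.one_mulVec, sub_eq_iff_eq_add] at hv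
      rw [hv, Complex.ofReal_add, add_smul]
      rfl
    have := groundEnergy_le_of_mulVec_eq hH hne this
    simpa using this
  have h := hp.re_dotProduct_nonneg ψ
  rw [Matrix.sub_mulVec, Matrix.smul_mulVec, Matrix.one_mulVec, dotProduct_sub,
    dotProduct_smul] at h
  simpa using h

omit [DecidableEq ι] in
lemma re_dotProduct_star_self_pos {ψ : ι → ℂ} (hψ : ψ ≠ 0) : 0 < (star ψ ⬝ᵥ ψ).re :=
  (Complex.pos_iff.1 (Matrix.dotProduct_star_self_pos_iff.2 hψ)).1

omit [Fintype ι] in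
lemma isHermitian_add_smul_one (hH : H.IsHermitian) (c : ℝ) :
    (H + (c : ℂ) • (1 : Matrix ι ι ℂ)).IsHermitian := by
  refine hH.add ?_
  rw [Matrix.IsHermitian, Matrix.conjTranspose_smul]
  simp

lemma groundEnergy_add_smul_one [Nonempty ι] (hH : H.IsHermitian) (c : ℝ) :
    groundEnergy (H + (c : ℂ) • 1) = groundEnergy H + c := by
  have hK := isHermitian_add_smul_one hH c
  apply le_antisymm
  · obtain ⟨ψ, h0, h⟩ := exists_isGroundState hH
    refine groundEnergy_le_of_mulVec_eq hK h0 ?_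
    rw [Matrix.add_mulVec, h, Matrix.smul_mulVec, Matrix.one_mulVec, Complex.ofReal_add, add_smul]
  · obtain ⟨ψ, h0, h⟩ := exists_isGroundState hK
    rw [← le_sub_iff_add_le]
    refine groundEnergy_le_of_mulVec_eq hH h0 ?_
    rw [Matrix.add_mulVec, Matrix.smul_mulVec, Matrix.one_mulVec, ← eq_sub_iff_add_eq] at h
    rw [h, Complex.ofReal_sub, sub_smul]

lemma partitionFunction_add_smul_one (β c : ℝ) :
    partitionFunction β (H + (c : ℂ) • 1) = Real.exp (-(β * c)) * partitionFunction β H := by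
  have h1 : -(β : ℂ) • (H + (c : ℂ) • 1) =
      -(β : ℂ) • H + ((-(β * c) : ℝ) : ℂ) • (1 : Matrix ι ι ℂ) := by
    rw [smul_add, smul_smul]
    push_cast
    simp
  rw [partitionFunction, h1,
    Matrix.exp_add_of_commute _ _ ((Commute.one_right _).smul_right _)]
  have : NormedSpace.exp (((-(β * c) : ℝ) : ℂ) • (1 : Matrix ι ι ℂ)) =
      ((Real.exp (-(β * c)) : ℝ) : ℂ) • 1 := by
    rw [Matrix.smul_one_eq_diagonal, Matrix.exp_diagonal, Matrix.smul_one_eq_diagonal]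
    congr 1
    ext i
    rw [Pi.coe_exp, ← Complex.exp_eq_exp_ℂ, Complex.ofReal_exp]
  rw [this, Matrix.mul_smul, Matrix.mul_one, Matrix.trace_smul, smul_eq_mul,
    Complex.re_ofReal_mul, partitionFunction]

lemma partitionFunction_eq_sum (hH : H.IsHermitian) (β : ℝ) :
    partitionFunction β H = ∑ i, Real.exp (-(β * hH.eigenvalues i)) := by
  set U : Matrix ι ι ℂ := (hH.eigenvectorUnitary : Matrix ι ι ℂ) with hU
  have hUu : IsUnit U := ⟨Unitary.toUnits hH.eigenvectorUnitary, rfl⟩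
  have hUi : U⁻¹ = star U :=
    Matrix.inv_eq_left_inv (Unitary.coe_star_mul_self hH.eigenvectorUnitary)
  have h := hH.spectral_theorem
  rw [Unitary.conjStarAlgAut_apply, ← hU] at h
  have h1 : -(β : ℂ) • H =
      U * diagonal (fun i => ((-(β * hH.eigenvalues i) : ℝ) : ℂ)) * U⁻¹ := by
    conv_lhs => rw [h]
    rw [← Matrix.smul_mul, ← Matrix.mul_smul, ← Matrix.diagonal_smul, hUi]
    congr 3
    ext i
    simp
  rw [partitionFunction, h1, Matrix.exp_conj _ _ hUu, Matrix.trace_mul_cycle,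
    Matrix.nonsing_inv_mul _ ((Matrix.isUnit_iff_isUnit_det _).1 hUu), Matrix.one_mul,
    Matrix.exp_diagonal, Matrix.trace_diagonal, Complex.re_sum]
  refine Finset.sum_congr rfl fun i _ => ?_
  rw [Pi.coe_exp, ← Complex.exp_eq_exp_ℂ, ← Complex.ofReal_exp, Complex.ofReal_re]

lemma partitionFunction_pos [Nonempty ι] (hH : H.IsHermitian) (β : ℝ) :
    0 < partitionFunction β H := by
  rw [partitionFunction_eq_sum hH]
  exact Finset.sum_pos (fun i _ => Real.exp_pos _) Finset.univ_nonempty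

lemma freeEnergy_add_smul_one [Nonempty ι] (hH : H.IsHermitian) {β : ℝ} (hβ : β ≠ 0) (c : ℝ) :
    freeEnergy β (H + (c : ℂ) • 1) = freeEnergy β H + c := by
  rw [freeEnergy, partitionFunction_add_smul_one,
    Real.log_mul (Real.exp_pos _).ne' (partitionFunction_pos hH β).ne', Real.log_exp, freeEnergy]
  field_simp
  ring

lemma freeEnergy_le_of_partitionFunction_le [Nonempty ι] {K : Matrix ι ι ℂ} (hK : K.IsHermitian)
    {β : ℝ} (hβ : 0 < β)
    (h : partitionFunction β K ≤ partitionFunction β H) : freeEnergy β H ≤ freeEnergy β K := by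
  have := Real.log_le_log (partitionFunction_pos hK β) h
  rw [freeEnergy, freeEnergy]
  exact mul_le_mul_of_nonpos_left this (by simpa using hβ.le)

/-- The zero-temperature limit of an inequality between partition functions. -/
lemma groundEnergy_le_of_partitionFunction_le [Nonempty ι] {K : Matrix ι ι ℂ}
    (hH : H.IsHermitian) (hK : K.IsHermitian)
    (h : ∀ β : ℝ, 0 < β → partitionFunction β K ≤ partitionFunction β H) :
    groundEnergy H ≤ groundEnergy K := by
  obtain ⟨i, hi⟩ := exists_eigenvalues_eq_groundEnergy hK
  have hcard : (0 : ℝ) < Fintype.card ι := by exact_mod_cast Fintype.card_pos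
  -- With `n` the dimension, `exp (-β E_K) ≤ Z_K ≤ Z_H ≤ n exp (-β E_H)`.
  have key : ∀ β : ℝ, 0 < β → β * (groundEnergy H - groundEnergy K) ≤
      Real.log (Fintype.card ι) := by
    intro β hβ
    have h1 : Real.exp (-(β * groundEnergy K)) ≤ partitionFunction β K := by
      rw [partitionFunction_eq_sum hK, ← hi]
      exact Finset.single_le_sum (f := fun j => Real.exp (-(β * hK.eigenvalues j)))
        (fun j _ => (Real.exp_pos _).le) (Finset.mem_univ i)
    have h2 : partitionFunction β H ≤ Fintype.card ι * Real.exp (-(β * groundEnergy H)) := by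
      rw [partitionFunction_eq_sum hH, ← nsmul_eq_mul, ← Finset.card_univ]
      refine Finset.sum_le_card_nsmul _ _ _ fun j _ => Real.exp_le_exp.2 ?_
      have := mul_le_mul_of_nonneg_left (groundEnergy_le_eigenvalues hH j) hβ.le
      linarith
    have h3 := Real.log_le_log (Real.exp_pos _) ((h1.trans (h β hβ)).trans h2)
    rw [Real.log_exp, Real.log_mul hcard.ne' (Real.exp_pos _).ne', Real.log_exp] at h3
    linarith
  by_contra! hlt
  have hd : 0 < groundEnergy H - groundEnergy K := sub_pos.2 hlt
  have hl : 0 ≤ Real.log (Fintype.card ι) :=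
    Real.log_nonneg (by exact_mod_cast Fintype.card_pos (α := ι))
  -- For this `β` the bound would read `log n + 1 ≤ log n`.
  have := key ((Real.log (Fintype.card ι) + 1) / (groundEnergy H - groundEnergy K))
    (by positivity)
  rw [div_mul_cancel₀ _ hd.ne'] at this
  linarith

end Hermitian

/-! ### One-site operators -/

section LocalOp

variable {I : Type*} [Fintype I] [DecidableEq I] {d : ℕ}

/-- The one-site operator `A` acting on the tensor factor `i` of a spin system with an arbitrary
finite set of sites. -/
def localOp (A : Matrix (Fin (d + 1)) (Fin (d + 1)) ℂ) (i : I) :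
    Matrix (I → Fin (d + 1)) (I → Fin (d + 1)) ℂ :=
  fun σ τ => if ∀ j, j ≠ i → σ j = τ j then A (σ i) (τ i) else 0

lemma localOp_add (A B : Matrix (Fin (d + 1)) (Fin (d + 1)) ℂ) (i : I) :
    localOp (A + B) i = localOp A i + localOp B i := by
  ext σ τ
  simp only [localOp, Matrix.add_apply]
  split_ifs <;> simp

lemma localOp_smul (c : ℂ) (A : Matrix (Fin (d + 1)) (Fin (d + 1)) ℂ) (i : I) :
    localOp (c • A) i = c • localOp A i := by
  ext σ τ
  simp only [localOp, Matrix.smul_apply]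
  split_ifs <;> simp

lemma localOp_neg (A : Matrix (Fin (d + 1)) (Fin (d + 1)) ℂ) (i : I) :
    localOp (-A) i = -localOp A i := by
  rw [← neg_one_smul ℂ, localOp_smul, neg_one_smul]

lemma localOp_conjMat (A : Matrix (Fin (d + 1)) (Fin (d + 1)) ℂ) (i : I) :
    localOp (conjMat A) i = (localOp A i).map (starRingEnd ℂ) := by
  ext σ τ
  simp only [localOp, Matrix.map_apply, RingHom.mapMatrix_apply]
  split_ifs <;> simp

lemma localOp_conjTranspose (A : Matrix (Fin (d + 1)) (Fin (d + 1)) ℂ) (i : I) :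
    (localOp A i)ᴴ = localOp Aᴴ i := by
  ext σ τ
  simp only [localOp, Matrix.conjTranspose_apply, eq_comm (a := σ _)]
  split_ifs <;> simp_all

lemma localOp_diagonal (f : Fin (d + 1) → ℂ) (i : I) :
    localOp (Matrix.diagonal f) i = Matrix.diagonal fun σ => f (σ i) := by
  ext σ τ
  by_cases h : σ = τ
  · subst h
    simp [localOp]
  · rw [Matrix.diagonal_apply_ne _ h, localOp]
    split_ifs with h'
    · refine Matrix.diagonal_apply_ne _ fun hi => h (funext fun j => ?_)
      by_cases hj : j = i
      · rw [hj, hi]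
      · exact h' j hj
    · rfl

end LocalOp

/-! ### Folding a spin system along a reflection -/

section Fold

open scoped Kronecker Matrix.Norms.Operator

variable {I : Type} [Fintype I] [DecidableEq I] {d : ℕ}

/-- Conjugation of a one-site operator by the matrix `|k⟩ ↦ (-1)^k |d - k⟩` of the rotation by `π`
about the second axis. -/
def rotate (A : Matrix (Fin (d + 1)) (Fin (d + 1)) ℂ) : Matrix (Fin (d + 1)) (Fin (d + 1)) ℂ :=
  fun k l => (-1) ^ (k : ℕ) * A k.rev l.rev * (-1) ^ (l : ℕ)

/-- The decomposition of the set of sites into two halves exchanged by a reflection. -/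
def reflectEquiv {θ : I → I} (hθ : Function.Involutive θ) {P : I → Prop} [DecidablePred P]
    (hP : ∀ i, P (θ i) ↔ ¬ P i) : {i // P i} ⊕ {i // P i} ≃ I where
  toFun := Sum.elim (fun i => i.1) (fun i => θ i.1)
  invFun i := if h : P i then Sum.inl ⟨i, h⟩ else Sum.inr ⟨θ i, (hP i).2 h⟩
  left_inv := by
    rintro (⟨i, hi⟩ | ⟨i, hi⟩)
    · simp [hi]
    · have : ¬ P (θ i) := fun h => (hP i).1 h hi
      simp [this, hθ i]
  right_inv i := by
    by_cases h : P i <;> simp [h, hθ i]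

variable {J : Type} [Fintype J] [DecidableEq J]

/-- Configurations of two halves as configurations of the whole system; the second half is
flipped. -/
def foldConfig (e : J ⊕ J ≃ I) :
    (J → Fin (d + 1)) × (J → Fin (d + 1)) ≃ (I → Fin (d + 1)) :=
  ((Equiv.refl _).prodCongr (Equiv.arrowCongr (Equiv.refl J) Fin.revPerm)).trans
    ((Equiv.sumArrowEquivProdArrow J J (Fin (d + 1))).symm.trans
      (Equiv.arrowCongr e (Equiv.refl _)))

omit [Fintype I] [DecidableEq I] [Fintype J] [DecidableEq J] in
@[simp] lemma foldConfig_inl (e : J ⊕ J ≃ I) (p : (J → Fin (d + 1)) × (J → Fin (d + 1))) (j : J) :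
    foldConfig e p (e (Sum.inl j)) = p.1 j := by
  simp [foldConfig, Equiv.arrowCongr, Equiv.sumArrowEquivProdArrow]

omit [Fintype I] [DecidableEq I] [Fintype J] [DecidableEq J] in
@[simp] lemma foldConfig_inr (e : J ⊕ J ≃ I) (p : (J → Fin (d + 1)) × (J → Fin (d + 1))) (j : J) :
    foldConfig e p (e (Sum.inr j)) = (p.2 j).rev := by
  simp [foldConfig, Equiv.arrowCongr, Equiv.sumArrowEquivProdArrow]

/-- The sign `∏ (-1)^(τ j)` of a configuration. -/
def configSign (τ : J → Fin (d + 1)) : ℂ := ∏ j, (-1) ^ (τ j : ℕ)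

omit [DecidableEq J] in
lemma configSign_mul_self (τ : J → Fin (d + 1)) : configSign τ * configSign τ = 1 := by
  rw [configSign, ← Finset.prod_mul_distrib]
  exact Finset.prod_eq_one fun j _ => by rw [← mul_pow]; simp

omit [DecidableEq J] in
lemma configSign_mul {σ τ : J → Fin (d + 1)} {j : J} (h : ∀ i, i ≠ j → σ i = τ i) :
    configSign σ * configSign τ = (-1) ^ (σ j : ℕ) * (-1) ^ (τ j : ℕ) := by
  rw [configSign, configSign, ← Finset.prod_mul_distrib]
  refine Finset.prod_eq_single j (fun i _ hi => ?_) (by simp)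
  rw [h i hi, ← mul_pow]
  simp

/-- The operators of the whole system as operators on the tensor product of two copies of one
half, where the spins of the second half are rotated by `π` about the second axis. -/
def foldHom (e : J ⊕ J ≃ I) :
    Matrix (I → Fin (d + 1)) (I → Fin (d + 1)) ℂ →ₐ[ℂ]
      Matrix ((J → Fin (d + 1)) × (J → Fin (d + 1))) ((J → Fin (d + 1)) × (J → Fin (d + 1))) ℂ :=
  AlgHom.ofLinearMap
    { toFun := fun X => diagonal (fun p => configSign p.2) *
        X.submatrix (foldConfig e) (foldConfig e) * diagonal (fun p => configSign p.2)
      map_add' := fun X Y => by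
        rw [Matrix.submatrix_add, Pi.add_apply, Pi.add_apply, Matrix.mul_add, Matrix.add_mul]
      map_smul' := fun c X => by
        rw [Matrix.submatrix_smul, Pi.smul_apply, Pi.smul_apply, Matrix.mul_smul, Matrix.smul_mul]
        rfl }
    (by
      simp [configSign_mul_self])
    (fun X Y => by
      have h : (diagonal (fun p : (J → Fin (d + 1)) × (J → Fin (d + 1)) => configSign p.2)) *
          diagonal (fun p => configSign p.2) = 1 := by
        simp [configSign_mul_self]
      simp only [LinearMap.coe_mk, AddHom.coe_mk]
      rw [← Matrix.submatrix_mul_equiv X Y _ (foldConfig e) _]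
      simp only [Matrix.mul_assoc]
      rw [← Matrix.mul_assoc (diagonal _) (diagonal _), h, Matrix.one_mul])

lemma foldHom_apply (e : J ⊕ J ≃ I) (X : Matrix (I → Fin (d + 1)) (I → Fin (d + 1)) ℂ)
    (p q : (J → Fin (d + 1)) × (J → Fin (d + 1))) :
    foldHom e X p q =
      configSign p.2 * X (foldConfig e p) (foldConfig e q) * configSign q.2 := by
  change (diagonal (fun p : (J → Fin (d + 1)) × (J → Fin (d + 1)) => configSign p.2) *
    X.submatrix (foldConfig e) (foldConfig e) *
    diagonal (fun p : (J → Fin (d + 1)) × (J → Fin (d + 1)) => configSign p.2)) p q = _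
  rw [Matrix.mul_diagonal, Matrix.diagonal_mul, Matrix.submatrix_apply]

lemma trace_foldHom (e : J ⊕ J ≃ I) (X : Matrix (I → Fin (d + 1)) (I → Fin (d + 1)) ℂ) :
    (foldHom e X).trace = X.trace := by
  rw [Matrix.trace, Matrix.trace, ← (foldConfig e).sum_comp]
  refine Finset.sum_congr rfl fun p _ => ?_
  rw [Matrix.diag_apply, foldHom_apply, mul_right_comm, configSign_mul_self, one_mul,
    Matrix.diag_apply]

lemma trace_exp_foldHom (e : J ⊕ J ≃ I) (X : Matrix (I → Fin (d + 1)) (I → Fin (d + 1)) ℂ) :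
    (NormedSpace.exp (foldHom e X)).trace = (NormedSpace.exp X).trace := by
  have hc : Continuous (foldHom (d := d) e) :=
    LinearMap.continuous_of_finiteDimensional (foldHom (d := d) e).toLinearMap
  exact (congrArg Matrix.trace (NormedSpace.map_exp (foldHom e) hc X)).symm.trans
    (trace_foldHom e _)

lemma foldHom_localOp_inl (e : J ⊕ J ≃ I) (A : Matrix (Fin (d + 1)) (Fin (d + 1)) ℂ) (j : J) :
    foldHom e (localOp A (e (Sum.inl j))) = localOp A j ⊗ₖ 1 := by
  ext ⟨σ, σ'⟩ ⟨τ, τ'⟩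
  rw [foldHom_apply, Matrix.kronecker_apply]
  have hiff : (∀ i, i ≠ e (Sum.inl j) → foldConfig e (σ, σ') i = foldConfig e (τ, τ') i) ↔
      (∀ i, i ≠ j → σ i = τ i) ∧ σ' = τ' := by
    rw [e.surjective.forall, Sum.forall]
    simp [funext_iff]
  simp only [localOp, hiff, foldConfig_inl, Matrix.one_apply]
  by_cases h' : σ' = τ'
  · subst h'
    simp only [and_true, if_true, mul_one]
    rw [mul_right_comm, configSign_mul_self, one_mul]
  · simp [h']

/-- The signs of all sites other than `j` cancel in pairs; those at `j`, with the flip built into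
`foldConfig`, make up `rotate`. -/
lemma foldHom_localOp_inr (e : J ⊕ J ≃ I) (A : Matrix (Fin (d + 1)) (Fin (d + 1)) ℂ) (j : J) :
    foldHom e (localOp A (e (Sum.inr j))) = 1 ⊗ₖ localOp (rotate A) j := by
  ext ⟨σ, σ'⟩ ⟨τ, τ'⟩
  rw [foldHom_apply, Matrix.kronecker_apply]
  have hiff : (∀ i, i ≠ e (Sum.inr j) → foldConfig e (σ, σ') i = foldConfig e (τ, τ') i) ↔
      σ = τ ∧ (∀ i, i ≠ j → σ' i = τ' i) := by
    rw [e.surjective.forall, Sum.forall]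
    simp [funext_iff]
  simp only [localOp, hiff, foldConfig_inr, Matrix.one_apply]
  by_cases h : σ = τ
  · by_cases h' : ∀ i, i ≠ j → σ' i = τ' i
    · simp only [h, true_and, if_pos h', if_true, one_mul, rotate]
      rw [mul_right_comm, configSign_mul h']
      ring
    · simp [h']
  · simp [h]

/-- The part of a one-site operator that acts on the half `P` of the system. -/
def halfSiteOp (P : I → Prop) [DecidablePred P] (A : Matrix (Fin (d + 1)) (Fin (d + 1)) ℂ) (i : I) :
    Matrix ({i // P i} → Fin (d + 1)) ({i // P i} → Fin (d + 1)) ℂ :=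
  if h : P i then localOp A ⟨i, h⟩ else 0

/-- One of the two terms is always zero. The two-term form lets boxes that straddle the cut be
treated by linearity. -/
lemma foldHom_localOp {θ : I → I} (hθ : Function.Involutive θ) {P : I → Prop} [DecidablePred P]
    (hP : ∀ i, P (θ i) ↔ ¬ P i) {A : Matrix (Fin (d + 1)) (Fin (d + 1)) ℂ}
    (hA : rotate A = -conjMat A) (i : I) :
    foldHom (reflectEquiv hθ hP) (localOp A i) =
      halfSiteOp P A i ⊗ₖ 1 - 1 ⊗ₖ conjMat (halfSiteOp P A (θ i)) := by
  by_cases h : P i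
  · have h' : ¬ P (θ i) := fun h' => (hP i).1 h' h
    have := foldHom_localOp_inl (reflectEquiv hθ hP) A ⟨i, h⟩
    rw [show reflectEquiv hθ hP (Sum.inl ⟨i, h⟩) = i from rfl] at this
    rw [this, halfSiteOp, halfSiteOp, dif_pos h, dif_neg h', map_zero, Matrix.kronecker_zero,
      sub_zero]
  · have h' : P (θ i) := (hP i).2 h
    have := foldHom_localOp_inr (reflectEquiv hθ hP) A ⟨θ i, h'⟩
    rw [show reflectEquiv hθ hP (Sum.inr ⟨θ i, h'⟩) = i from hθ i] at this
    rw [this, halfSiteOp, halfSiteOp, dif_neg h, dif_pos h', Matrix.zero_kronecker, zero_sub,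
      hA, localOp_neg, localOp_conjMat]
    ext
    simp

end Fold

/-! ### Spin matrices -/

section Spin

variable (d : ℕ)

lemma rotate_add (A B : Matrix (Fin (d + 1)) (Fin (d + 1)) ℂ) :
    rotate (A + B) = rotate A + rotate B := by
  ext k l
  simp only [rotate, Matrix.add_apply]
  ring

lemma rotate_smul (c : ℂ) (A : Matrix (Fin (d + 1)) (Fin (d + 1)) ℂ) :
    rotate (c • A) = c • rotate A := by
  ext k l
  simp only [rotate, Matrix.smul_apply, smul_eq_mul]
  ring

/-- The flip `k ↦ d - k` exchanges raising and lowering with the same coefficients; the sign is the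
product of the parities of two neighbouring indices. -/
lemma rotate_spinRaise : rotate (spinRaise d) = -(spinRaise d)ᴴ := by
  ext k l
  simp only [rotate, spinRaise, Matrix.neg_apply, Matrix.conjTranspose_apply, Fin.val_rev]
  by_cases h : (l : ℕ) + 1 = k
  · have hk := k.2
    have h1 : d + 1 - ((k : ℕ) + 1) + 1 = d + 1 - ((l : ℕ) + 1) := by omega
    rw [if_pos h1, if_pos h]
    have h2 : ((d + 1 - ((l : ℕ) + 1) : ℕ) : ℝ) = d - l := by
      rw [Nat.cast_sub (by omega)]
      push_cast
      ring
    have h3 : ((k : ℕ) : ℝ) = l + 1 := by rw [← h]; push_cast; ring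
    rw [h2, h3, mul_right_comm, ← h, pow_succ]
    have h4 : ((-1 : ℂ) ^ (l : ℕ)) * -1 * (-1) ^ (l : ℕ) = -1 := by
      rw [mul_right_comm, ← mul_pow]
      simp
    rw [h4, neg_one_mul, Complex.star_def, Complex.conj_ofReal,
      show ((d : ℝ) - l) * (d + 1 - (d - l)) = (l + 1) * (d + 1 - (l + 1)) by ring]
  · have hl := l.2
    have h1 : ¬ (d + 1 - ((k : ℕ) + 1) + 1 = d + 1 - ((l : ℕ) + 1)) := by
      have := k.2
      omega
    rw [if_neg h1, if_neg h]
    simp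

lemma rotate_spinRaise_conjTranspose : rotate (spinRaise d)ᴴ = -spinRaise d := by
  have h := rotate_spinRaise d
  have h2 : rotate (spinRaise d)ᴴ = (rotate (spinRaise d))ᴴ := by
    ext k l
    simp only [rotate, Matrix.conjTranspose_apply, star_mul', star_pow, star_neg, star_one]
    ring
  rw [h2, h, Matrix.conjTranspose_neg, Matrix.conjTranspose_conjTranspose]

lemma conjMat_spinRaise : conjMat (spinRaise d) = spinRaise d := by
  ext k l
  simp only [spinRaise, RingHom.mapMatrix_apply, Matrix.map_apply]
  split_ifs
  · exact Complex.conj_ofReal _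
  · simp

lemma conjMat_spinRaise_conjTranspose : conjMat (spinRaise d)ᴴ = (spinRaise d)ᴴ := by
  conv_rhs => rw [← conjMat_spinRaise]
  ext k l
  simp

lemma conjMat_smul {n : Type} [Fintype n] [DecidableEq n] (c : ℂ) (A : Matrix n n ℂ) :
    conjMat (c • A) = (starRingEnd ℂ c) • conjMat A := by
  ext
  simp

/-- The rotation reverses the first and third components and fixes the second, whereas conjugation
fixes the first and third and reverses the second. So the same relation, with the same sign, holds
for all three components. -/
lemma rotate_spin1 : rotate (spin1 d) = -conjMat (spin1 d) := by
  rw [spin1, rotate_smul, rotate_add, rotate_spinRaise, rotate_spinRaise_conjTranspose,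
    conjMat_smul, map_add, conjMat_spinRaise, conjMat_spinRaise_conjTranspose, ← smul_neg]
  simp only [map_div₀, map_one, map_ofNat]
  congr 1
  abel

lemma rotate_spin2 : rotate (spin2 d) = -conjMat (spin2 d) := by
  have h : spinRaise d - (spinRaise d)ᴴ = spinRaise d + (-1 : ℂ) • (spinRaise d)ᴴ := by
    rw [neg_one_smul, sub_eq_add_neg]
  rw [spin2, rotate_smul, conjMat_smul, map_sub, conjMat_spinRaise,
    conjMat_spinRaise_conjTranspose, h, rotate_add, rotate_smul, rotate_spinRaise,
    rotate_spinRaise_conjTranspose]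
  simp only [map_div₀, map_one, map_mul, map_ofNat, Complex.conj_I, mul_neg, div_neg, neg_smul,
    neg_neg]
  congr 1
  simp only [one_smul, neg_neg]
  abel

lemma rotate_spin3 : rotate (spin3 d) = -conjMat (spin3 d) := by
  ext k l
  by_cases h : k = l
  · subst h
    have hk : ((d + 1 - ((k : ℕ) + 1) : ℕ) : ℂ) = d - k := by
      rw [Nat.cast_sub (by omega)]
      push_cast
      ring
    simp only [rotate, spin3, Matrix.diagonal_apply_eq, Fin.val_rev, Matrix.neg_apply,
      RingHom.mapMatrix_apply, Matrix.map_apply, map_sub, map_div₀, map_natCast, map_ofNat, hk]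
    rw [mul_right_comm, ← mul_pow]
    norm_num
    ring
  · simp [rotate, spin3, h]

lemma isHermitian_spin1 : (spin1 d).IsHermitian := by
  rw [Matrix.IsHermitian, spin1, Matrix.conjTranspose_smul, Matrix.conjTranspose_add,
    Matrix.conjTranspose_conjTranspose, add_comm (spinRaise d)]
  simp

lemma isHermitian_spin2 : (spin2 d).IsHermitian := by
  rw [Matrix.IsHermitian, spin2, Matrix.conjTranspose_smul, Matrix.conjTranspose_sub,
    Matrix.conjTranspose_conjTranspose, ← neg_sub, smul_neg, ← neg_smul]
  congr 1
  simp

lemma isHermitian_spin3 : (spin3 d).IsHermitian := by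
  rw [Matrix.IsHermitian, spin3, Matrix.diagonal_conjTranspose]
  congr 1
  ext k
  simp

end Spin

/-! ### Reflection positivity -/

section Reflection

open scoped Kronecker

variable {n : Type} [Fintype n] [DecidableEq n] {Y : Type*} [Fintype Y]

/-- The hamiltonian of a system folded along a reflection `θ` of the interaction terms: `T y` is
the part in the first half of the term `y`. -/
def foldedHamiltonian (θ : Y → Y) (T : Y → Matrix n n ℂ) (b : Y → ℝ) :
    Matrix (n × n) (n × n) ℂ :=
  (1 / 2 : ℂ) • ∑ y, (T y ⊗ₖ 1 - 1 ⊗ₖ conjMat (T (θ y)) - (b y : ℂ) • 1) ^ 2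

/-- The cross term is negative here, hence positive in `-β H`, as the trace inequality requires. -/
lemma sub_kronecker_sq (G G' : Matrix n n ℂ) :
    (G ⊗ₖ (1 : Matrix n n ℂ) - (1 : Matrix n n ℂ) ⊗ₖ conjMat G') ^ 2 =
      (G ^ 2) ⊗ₖ 1 + 1 ⊗ₖ conjMat (G' ^ 2) - (2 : ℂ) • (G ⊗ₖ conjMat G') := by
  rw [sq, sub_mul, mul_sub, mul_sub, ← Matrix.mul_kronecker_mul, ← Matrix.mul_kronecker_mul,
    ← Matrix.mul_kronecker_mul, ← Matrix.mul_kronecker_mul, two_smul, map_pow, sq, sq]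
  simp only [Matrix.mul_one, Matrix.one_mul]
  abel

omit [Fintype n] [DecidableEq n] in
lemma sub_kronecker (A A' B : Matrix n n ℂ) : (A - A') ⊗ₖ B = A ⊗ₖ B - A' ⊗ₖ B := by
  ext p q
  simp [sub_mul]

omit [Fintype n] [DecidableEq n] in
lemma kronecker_sub (A B B' : Matrix n n ℂ) : A ⊗ₖ (B - B') = A ⊗ₖ B - A ⊗ₖ B' := by
  ext p q
  simp [mul_sub]

omit [Fintype n] [DecidableEq n] in
lemma sum_kronecker {ι : Type*} (s : Finset ι) (A : ι → Matrix n n ℂ) (B : Matrix n n ℂ) :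
    (∑ i ∈ s, A i) ⊗ₖ B = ∑ i ∈ s, A i ⊗ₖ B := by
  ext p q
  simp [Matrix.sum_apply, Finset.sum_mul]

omit [Fintype n] [DecidableEq n] in
lemma kronecker_sum {ι : Type*} (s : Finset ι) (A : Matrix n n ℂ) (B : ι → Matrix n n ℂ) :
    A ⊗ₖ (∑ i ∈ s, B i) = ∑ i ∈ s, A ⊗ₖ B i := by
  ext p q
  simp [Matrix.sum_apply, Finset.mul_sum]

variable [DecidableEq Y]

/-- Writing the field as `u y - v (θ y)` absorbs it into the two halves: `T` is shifted by `u` in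
the first and by `v` in the second. For a term not fixed by `θ` one of the shifted operators is
zero, so only cut terms leave a cross term. -/
lemma smul_foldedHamiltonian {θ : Y → Y} (hθ : Function.Involutive θ) {T : Y → Matrix n n ℂ}
    {β : ℝ} (hβ : 0 ≤ β) {u v : Y → ℝ}
    (h : ∀ y, θ y ≠ y → (T y = 0 ∧ u y = 0) ∨ (T (θ y) = 0 ∧ v (θ y) = 0)) :
    -(β : ℂ) • foldedHamiltonian θ T (fun y => u y - v (θ y)) =
      (-(β / 2 : ℂ) • ∑ y, (T y - (u y : ℂ) • 1) ^ 2) ⊗ₖ 1 +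
      1 ⊗ₖ conjMat (-(β / 2 : ℂ) • ∑ y, (T y - (v y : ℂ) • 1) ^ 2) +
      ∑ y, (if θ y = y then ((Real.sqrt β : ℝ) : ℂ) • (T y - (u y : ℂ) • 1) else 0) ⊗ₖ
        conjMat (if θ y = y then ((Real.sqrt β : ℝ) : ℂ) • (T y - (v y : ℂ) • 1) else 0) := by
  have hs : ((Real.sqrt β : ℝ) : ℂ) * ((Real.sqrt β : ℝ) : ℂ) = β := by
    rw [← Complex.ofReal_mul, Real.mul_self_sqrt hβ]
  set G : Y → Matrix n n ℂ := fun y => T y - (u y : ℂ) • 1 with hG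
  set G' : Y → Matrix n n ℂ := fun y => T y - (v y : ℂ) • 1 with hG'
  have hterm : ∀ y, (T y ⊗ₖ 1 - 1 ⊗ₖ conjMat (T (θ y)) -
      ((u y - v (θ y) : ℝ) : ℂ) • (1 : Matrix (n × n) (n × n) ℂ)) ^ 2 =
      (G y ^ 2) ⊗ₖ 1 + 1 ⊗ₖ conjMat (G' (θ y) ^ 2) - (2 : ℂ) • (G y ⊗ₖ conjMat (G' (θ y))) := by
    intro y
    rw [← sub_kronecker_sq]
    congr 1
    simp only [hG, hG', map_sub, conjMat_smul, map_one, Complex.conj_ofReal, sub_kronecker,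
      kronecker_sub, Matrix.smul_kronecker, Matrix.kronecker_smul, Matrix.one_kronecker_one,
      Complex.ofReal_sub, sub_smul]
    abel
  have hcut : ∀ y, (β : ℂ) • (G y ⊗ₖ conjMat (G' (θ y))) =
      (if θ y = y then ((Real.sqrt β : ℝ) : ℂ) • G y else 0) ⊗ₖ
        conjMat (if θ y = y then ((Real.sqrt β : ℝ) : ℂ) • G' y else 0) := by
    intro y
    by_cases hy : θ y = y
    · rw [if_pos hy, if_pos hy, conjMat_smul, Complex.conj_ofReal, Matrix.smul_kronecker,
        Matrix.kronecker_smul, smul_smul, hs, hy]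
    · rw [if_neg hy, if_neg hy, Matrix.zero_kronecker]
      rcases h y hy with ⟨h1, h2⟩ | ⟨h1, h2⟩
      · simp [hG, h1, h2]
      · simp [hG', h1, h2]
  have hperm : ∑ y, (1 : Matrix n n ℂ) ⊗ₖ conjMat (G' (θ y) ^ 2) =
      ∑ y, (1 : Matrix n n ℂ) ⊗ₖ conjMat (G' y ^ 2) :=
    Equiv.sum_comp hθ.toPerm fun y => (1 : Matrix n n ℂ) ⊗ₖ conjMat (G' y ^ 2)
  have hb : starRingEnd ℂ (-(β / 2 : ℂ)) = -(β / 2 : ℂ) := by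
    rw [map_neg, map_div₀, Complex.conj_ofReal, map_ofNat]
  rw [foldedHamiltonian, Finset.sum_congr rfl fun y _ => hterm y, Finset.sum_sub_distrib,
    Finset.sum_add_distrib, hperm, conjMat_smul, hb, Matrix.smul_kronecker, Matrix.kronecker_smul,
    map_sum, sum_kronecker, kronecker_sum, ← Finset.sum_congr rfl fun y _ => hcut y,
    ← Finset.smul_sum, ← Finset.smul_sum, smul_smul, smul_sub, smul_add, smul_smul]
  rw [show -(β : ℂ) * (1 / 2) = -(β / 2) by ring, show -(β / 2 : ℂ) * 2 = -β by ring,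
    neg_smul (β : ℂ), sub_neg_eq_add]

/-- Reflection positivity of partition functions in external fields `b`. The number `w y` is `1`
for the terms in the first half, `1 / 2` for the terms cut by the reflection, and `0` for the terms
in the second half. -/
lemma foldedHamiltonian_reflection {θ : Y → Y} (hθ : Function.Involutive θ) {T : Y → Matrix n n ℂ}
    {w : Y → ℝ} (hw : ∀ y, w y + w (θ y) = 1)
    (hT : ∀ y, θ y ≠ y → (T y = 0 ∧ w y = 0) ∨ (T (θ y) = 0 ∧ w (θ y) = 0))
    {β : ℝ} (hβ : 0 ≤ β) (b : Y → ℝ) :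
    ‖(NormedSpace.exp (-(β : ℂ) • foldedHamiltonian θ T b)).trace‖ ^ 2 ≤
      partitionFunction β (foldedHamiltonian θ T fun y => w y * b y - w (θ y) * b (θ y)) *
      partitionFunction β (foldedHamiltonian θ T fun y => w (θ y) * b y - w y * b (θ y)) := by
  -- Replacing `v` by `u`, or `u` by `v`, gives the two reflected fields. On a cut term `u = b / 2 =
  -- -v`, so there both reflected fields are zero.
  set u : Y → ℝ := fun y => w y * b y with hu
  set v : Y → ℝ := fun y => -(w y * b (θ y)) with hv
  have e0 : b = fun y => u y - v (θ y) := by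
    funext y
    simp only [hu, hv, hθ y]
    linear_combination -(b y) * hw y
  have e1 : (fun y => w y * b y - w (θ y) * b (θ y)) = fun y => u y - u (θ y) := rfl
  have e2 : (fun y => w (θ y) * b y - w y * b (θ y)) = fun y => v y - v (θ y) := by
    funext y
    simp only [hv, hθ y]
    ring
  rw [e1, e2]
  conv_lhs => rw [e0]
  rw [partitionFunction, partitionFunction, smul_foldedHamiltonian hθ hβ,
    smul_foldedHamiltonian hθ hβ, smul_foldedHamiltonian hθ hβ]
  · exact norm_trace_exp_sq_le _ _ _ _
  all_goals
    intro y hy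
    rcases hT y hy with ⟨h1, h2⟩ | ⟨h1, h2⟩
    · exact Or.inl ⟨h1, by simp [hu, hv, h2]⟩
    · exact Or.inr ⟨h1, by simp [hu, hv, h2]⟩

end Reflection

/-! ### Reflections of the checkerboard -/

section Lattice

open scoped Kronecker

lemma siteOp_eq_localOp {M N : ℕ} [NeZero M] [NeZero N] {d : ℕ}
    (A : Matrix (Fin (d + 1)) (Fin (d + 1)) ℂ) (i : Site M N) : siteOp A i = localOp A i := by
  ext σ τ
  simp only [siteOp, localOp]

lemma natCast_val_two {M : ℕ} [NeZero M] (hM : 2 ∣ M) (a : ZMod M) :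
    ((a.val : ℕ) : ZMod 2) = ZMod.castHom hM (ZMod 2) a := by
  rw [ZMod.castHom_apply, ZMod.natCast_val]

lemma even_val_add_val_iff {M N : ℕ} [NeZero M] [NeZero N] (hM : 2 ∣ M) (hN : 2 ∣ N) (a : ZMod M)
    (b : ZMod N) : Even (a.val + b.val) ↔
      ZMod.castHom hM (ZMod 2) a + ZMod.castHom hN (ZMod 2) b = 0 := by
  rw [← natCast_val_two, ← natCast_val_two, ← Nat.cast_add, ZMod.natCast_eq_zero_iff_even]

lemma val_neg_sub_one {M : ℕ} [NeZero M] (k : ZMod M) : (-k - 1).val = M - 1 - k.val := by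
  have hk := ZMod.val_lt k
  have : -k - 1 = ((M - 1 - k.val : ℕ) : ZMod M) := by
    rw [Nat.sub_sub, Nat.cast_sub (by omega)]
    simp
    ring
  rw [this, ZMod.val_natCast_of_lt (by omega)]

variable {M N : ℕ} [NeZero M] [NeZero N]

/-- The reflection of sites that exchanges the columns `c` and `c + 1`. -/
def reflSite (c : ZMod M) (i : Site M N) : Site M N := (2 * c + 1 - i.1, i.2)

omit [NeZero M] [NeZero N] in
lemma reflSite_involutive (c : ZMod M) : Function.Involutive (reflSite (N := N) c) := fun i => by
  ext <;> simp [reflSite]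

/-- The columns `c + 1, …, c + M / 2`. -/
def IsFirstHalf (c : ZMod M) (i : Site M N) : Prop := 2 * (i.1 - c - 1).val < M

instance (c : ZMod M) : DecidablePred (IsFirstHalf (N := N) c) :=
  fun i => inferInstanceAs (Decidable (2 * (i.1 - c - 1).val < M))

omit [NeZero N] in
lemma isFirstHalf_reflSite (hM : Even M) (c : ZMod M) (i : Site M N) :
    IsFirstHalf c (reflSite c i) ↔ ¬ IsFirstHalf c i := by
  have hk := ZMod.val_lt (i.1 - c - 1)
  have : (2 * c + 1 - i.1) - c - 1 = -(i.1 - c - 1) - 1 := by ring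
  rw [IsFirstHalf, IsFirstHalf, reflSite, this, val_neg_sub_one]
  obtain ⟨m, hm⟩ := hM
  omega

omit [NeZero N] in
/-- A box that is not fixed by the reflection has both its columns in the same half. -/
lemma isFirstHalf_succ (hM : Even M) {c : ZMod M} {i : ZMod M} (j j' : ZMod N)
    (h : 2 * c - i ≠ i) : IsFirstHalf c (i + 1, j) ↔ IsFirstHalf c (i, j') := by
  simp only [IsFirstHalf]
  have hk := ZMod.val_lt (i - c - 1)
  have e1 : i + 1 - c - 1 = (i - c - 1) + 1 := by ring
  have e2 : (((i - c - 1).val : ℕ) : ZMod M) = i - c - 1 := ZMod.natCast_zmod_val _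
  obtain ⟨m, hm⟩ := hM
  rw [e1]
  set k := (i - c - 1).val with hkdef
  -- The half changes between columns `i` and `i + 1` only at `k + 1 = M`, where `i = c`, and at `2
  -- (k + 1) = M`, the opposite cut; both columns are fixed by `i ↦ 2c - i`.
  have hk1 : k + 1 ≠ M := by
    intro hk1
    have h0 : ((k + 1 : ℕ) : ZMod M) = 0 := by rw [hk1, ZMod.natCast_self]
    push_cast at h0
    apply h
    rw [e2] at h0
    linear_combination (-2) * h0
  have hk2 : 2 * (k + 1) ≠ M := by
    intro hk2
    have h0 : ((2 * (k + 1) : ℕ) : ZMod M) = 0 := by rw [hk2, ZMod.natCast_self]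
    push_cast at h0
    apply h
    rw [e2] at h0
    linear_combination -h0
  have e3 : (i - c - 1 + 1).val = k + 1 := by
    rw [← e2, ← Nat.cast_one, ← Nat.cast_add, ZMod.val_natCast_of_lt (by omega)]
  rw [e3]
  omega

/-- The reflection of boxes induced by `reflSite`. -/
def reflBox (hM : Even M) (hN : Even N) (c : ZMod M) (x : Box M N) : Box M N :=
  ⟨(2 * c - x.1.1, x.1.2), by
    have h := x.2
    rw [even_val_add_val_iff hM.two_dvd hN.two_dvd] at h ⊢
    rw [map_sub, map_mul, map_ofNat, show (2 : ZMod 2) = 0 from rfl, zero_mul, zero_sub,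
      ZMod.neg_eq_self_mod_two, h]⟩

lemma reflBox_involutive (hM : Even M) (hN : Even N) (c : ZMod M) :
    Function.Involutive (reflBox hM hN c) := fun x => by
  apply Subtype.ext
  ext <;> simp [reflBox]

lemma reflBox_eq_iff (hM : Even M) (hN : Even N) (c : ZMod M) (x : Box M N) :
    reflBox hM hN c x = x ↔ 2 * c - x.1.1 = x.1.1 := by
  rw [Subtype.ext_iff, Prod.ext_iff]
  simp [reflBox]

/-- The weight `1`, `1 / 2` or `0` of a box in the first half, cut by the reflection, or in the
second half. -/
def halfWeight (hM : Even M) (hN : Even N) (c : ZMod M) (x : Box M N) : ℝ :=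
  if reflBox hM hN c x = x then 1 / 2 else if IsFirstHalf c x.1 then 1 else 0

/-- The left column of the reflected box is the mirror image of the right column of `x`, which for
an uncut box lies in the same half as the left one. -/
lemma isFirstHalf_reflBox (hM : Even M) (hN : Even N) {c : ZMod M} {x : Box M N}
    (h : reflBox hM hN c x ≠ x) : IsFirstHalf c (reflBox hM hN c x).1 ↔ ¬ IsFirstHalf c x.1 := by
  have h' := h
  rw [Ne, reflBox_eq_iff] at h'
  have e : (reflBox hM hN c x).1 = reflSite c (x.1.1 + 1, x.1.2) := by
    simp [reflBox, reflSite]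
  rw [e, isFirstHalf_reflSite hM, isFirstHalf_succ hM x.1.2 x.1.2 h']

lemma halfWeight_add_reflBox (hM : Even M) (hN : Even N) (c : ZMod M) (x : Box M N) :
    halfWeight hM hN c x + halfWeight hM hN c (reflBox hM hN c x) = 1 := by
  by_cases h : reflBox hM hN c x = x
  · rw [h, halfWeight, if_pos h]
    norm_num
  · have h' : reflBox hM hN c (reflBox hM hN c x) ≠ reflBox hM hN c x := by
      rw [reflBox_involutive hM hN c x]
      exact Ne.symm h
    rw [halfWeight, halfWeight, if_neg h, if_neg h']
    have := isFirstHalf_reflBox hM hN h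
    by_cases hx : IsFirstHalf c x.1 <;> simp [this, hx]

/-- The part of a box operator that acts on the first half. -/
def halfBoxOp (c : ZMod M) {d : ℕ} (A : Matrix (Fin (d + 1)) (Fin (d + 1)) ℂ) (x : Box M N) :
    Matrix ({i : Site M N // IsFirstHalf c i} → Fin (d + 1))
      ({i : Site M N // IsFirstHalf c i} → Fin (d + 1)) ℂ :=
  halfSiteOp (IsFirstHalf c) A (x.1.1, x.1.2) + halfSiteOp (IsFirstHalf c) A (x.1.1 + 1, x.1.2) +
    halfSiteOp (IsFirstHalf c) A (x.1.1, x.1.2 + 1) +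
    halfSiteOp (IsFirstHalf c) A (x.1.1 + 1, x.1.2 + 1)

lemma halfBoxOp_eq_zero (hM : Even M) (hN : Even N) {c : ZMod M} {d : ℕ}
    (A : Matrix (Fin (d + 1)) (Fin (d + 1)) ℂ) {x : Box M N} (h : reflBox hM hN c x ≠ x)
    (hx : ¬ IsFirstHalf c x.1) : halfBoxOp c A x = 0 := by
  rw [Ne, reflBox_eq_iff] at h
  have h1 := isFirstHalf_succ hM x.1.2 x.1.2 h
  have h2 := isFirstHalf_succ hM (x.1.2 + 1) x.1.2 h
  have h3 : ¬ IsFirstHalf c (x.1.1, x.1.2 + 1) := hx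
  rw [halfBoxOp, halfSiteOp, halfSiteOp, halfSiteOp, halfSiteOp, dif_neg (by exact hx),
    dif_neg (by rw [h1]; exact hx), dif_neg h3, dif_neg (by rw [h2]; exact hx)]
  simp

lemma foldHom_boxOp (hM : Even M) (hN : Even N) (c : ZMod M) {d : ℕ}
    {A : Matrix (Fin (d + 1)) (Fin (d + 1)) ℂ} (hA : rotate A = -conjMat A) (x : Box M N) :
    foldHom (reflectEquiv (reflSite_involutive c) (isFirstHalf_reflSite hM c)) (boxOp A x) =
      halfBoxOp c A x ⊗ₖ 1 - 1 ⊗ₖ conjMat (halfBoxOp c A (reflBox hM hN c x)) := by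
  have e1 : 2 * c + 1 - x.1.1 = 2 * c - x.1.1 + 1 := by ring
  have e2 : 2 * c + 1 - (x.1.1 + 1) = 2 * c - x.1.1 := by ring
  simp only [boxOp, halfBoxOp, map_add, siteOp_eq_localOp, foldHom_localOp _ _ hA,
    Matrix.add_kronecker, Matrix.kronecker_add, reflSite, reflBox, e1, e2]
  abel

/-- The three spin components. -/
def spin (d : ℕ) : Fin 3 → Matrix (Fin (d + 1)) (Fin (d + 1)) ℂ := ![spin1 d, spin2 d, spin3 d]

lemma rotate_spin (d : ℕ) (a : Fin 3) : rotate (spin d a) = -conjMat (spin d a) := by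
  fin_cases a
  · exact rotate_spin1 d
  · exact rotate_spin2 d
  · exact rotate_spin3 d

/-- Each pair of box and component becomes one interaction term; the index `2 : Fin 3` is the third
component, the only one with a field. -/
lemma hamiltonian_eq_sum (d : ℕ) (b : Box M N → ℝ) :
    hamiltonian d b = (1 / 2 : ℂ) • ∑ y : Box M N × Fin 3,
      (boxOp (spin d y.2) y.1 - ((if y.2 = 2 then b y.1 else 0 : ℝ) : ℂ) • 1) ^ 2 := by
  rw [hamiltonian, Fintype.sum_prod_type]
  congr 1
  refine Finset.sum_congr rfl fun x _ => ?_
  rw [Fin.sum_univ_three]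
  simp [spin]

lemma foldHom_hamiltonian (hM : Even M) (hN : Even N) (c : ZMod M) (d : ℕ) (b : Box M N → ℝ) :
    foldHom (reflectEquiv (reflSite_involutive c) (isFirstHalf_reflSite hM c)) (hamiltonian d b) =
      foldedHamiltonian (fun y : Box M N × Fin 3 => (reflBox hM hN c y.1, y.2))
        (fun y => halfBoxOp c (spin d y.2) y.1) (fun y => if y.2 = 2 then b y.1 else 0) := by
  rw [hamiltonian_eq_sum, foldedHamiltonian, map_smul, map_sum]
  refine congrArg (fun X => (1 / 2 : ℂ) • X) (Finset.sum_congr rfl fun y _ => ?_)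
  rw [map_pow, map_sub, map_smul, map_one, foldHom_boxOp hM hN c (rotate_spin d y.2)]

lemma partitionFunction_foldHom {J : Type} [Fintype J] [DecidableEq J] {d : ℕ}
    (e : J ⊕ J ≃ Site M N) (β : ℝ) (H : Matrix (Config M N d) (Config M N d) ℂ) :
    partitionFunction β (foldHom e H) = partitionFunction β H := by
  rw [partitionFunction, ← map_smul, trace_exp_foldHom, partitionFunction]

lemma partitionFunction_hamiltonian_sq_le (hM : Even M) (hN : Even N) (c : ZMod M) (d : ℕ) {β : ℝ}
    (hβ : 0 ≤ β) (b : Box M N → ℝ) :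
    partitionFunction β (hamiltonian d b) ^ 2 ≤
      partitionFunction β (hamiltonian d fun x => halfWeight hM hN c x * b x -
        halfWeight hM hN c (reflBox hM hN c x) * b (reflBox hM hN c x)) *
      partitionFunction β (hamiltonian d fun x => halfWeight hM hN c (reflBox hM hN c x) * b x -
        halfWeight hM hN c x * b (reflBox hM hN c x)) := by
  set e := reflectEquiv (reflSite_involutive (N := N) c) (isFirstHalf_reflSite hM c) with he
  have hθ : Function.Involutive
      (fun y : Box M N × Fin 3 => (reflBox hM hN c y.1, y.2)) := fun y => by
    ext1
    · exact reflBox_involutive hM hN c y.1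
    · rfl
  have key := foldedHamiltonian_reflection hθ (T := fun y => halfBoxOp c (spin d y.2) y.1)
    (w := fun y => halfWeight hM hN c y.1) (fun y => halfWeight_add_reflBox hM hN c y.1)
    (fun y hy => by
      have hy' : reflBox hM hN c y.1 ≠ y.1 := fun h => hy (Prod.ext h rfl)
      have hy'' : reflBox hM hN c (reflBox hM hN c y.1) ≠ reflBox hM hN c y.1 := by
        rw [reflBox_involutive hM hN c y.1]
        exact Ne.symm hy'
      by_cases hx : IsFirstHalf c y.1.1
      · have hx' : ¬ IsFirstHalf c (reflBox hM hN c y.1).1 := fun h =>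
          (isFirstHalf_reflBox hM hN hy').1 h hx
        refine Or.inr ⟨halfBoxOp_eq_zero hM hN _ hy'' hx', ?_⟩
        simp only [halfWeight]
        rw [if_neg hy'', if_neg hx']
      · refine Or.inl ⟨halfBoxOp_eq_zero hM hN _ hy' hx, ?_⟩
        simp only [halfWeight]
        rw [if_neg hy', if_neg hx])
    hβ (fun y => if y.2 = 2 then b y.1 else 0)
  rw [← partitionFunction_foldHom e, ← partitionFunction_foldHom e, ← partitionFunction_foldHom e,
    foldHom_hamiltonian hM hN, foldHom_hamiltonian hM hN, foldHom_hamiltonian hM hN]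
  have hre : ∀ z : ℂ, z.re ^ 2 ≤ ‖z‖ ^ 2 := fun z => by
    rw [← sq_abs]
    gcongr
    exact Complex.abs_re_le_norm z
  refine (hre _).trans (key.trans (le_of_eq ?_))
  congr 3 <;>
  · funext y
    by_cases hy : y.2 = 2 <;> simp [hy]

lemma isHermitian_siteOp {d : ℕ} {A : Matrix (Fin (d + 1)) (Fin (d + 1)) ℂ} (hA : A.IsHermitian)
    (i : Site M N) : (siteOp A i).IsHermitian := by
  rw [Matrix.IsHermitian, siteOp_eq_localOp, localOp_conjTranspose, hA]

lemma isHermitian_boxOp {d : ℕ} {A : Matrix (Fin (d + 1)) (Fin (d + 1)) ℂ} (hA : A.IsHermitian)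
    (x : Box M N) : (boxOp A x).IsHermitian :=
  (((isHermitian_siteOp hA _).add (isHermitian_siteOp hA _)).add (isHermitian_siteOp hA _)).add
    (isHermitian_siteOp hA _)

lemma isHermitian_ofReal_smul {ι : Type*} {A : Matrix ι ι ℂ} (hA : A.IsHermitian) (c : ℝ) :
    ((c : ℂ) • A).IsHermitian := by
  rw [Matrix.IsHermitian, Matrix.conjTranspose_smul, hA]
  simp

lemma isHermitian_spin (d : ℕ) (a : Fin 3) : (spin d a).IsHermitian := by
  fin_cases a
  · exact isHermitian_spin1 d
  · exact isHermitian_spin2 d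
  · exact isHermitian_spin3 d

lemma isHermitian_hamiltonian (d : ℕ) (b : Box M N → ℝ) : (hamiltonian d b).IsHermitian := by
  rw [hamiltonian_eq_sum, show (1 / 2 : ℂ) = ((1 / 2 : ℝ) : ℂ) by norm_num]
  refine isHermitian_ofReal_smul ?_ _
  rw [Matrix.IsHermitian, Matrix.conjTranspose_sum]
  refine Finset.sum_congr rfl fun y _ => ?_
  exact ((isHermitian_boxOp (isHermitian_spin d _) _).sub
    (isHermitian_ofReal_smul Matrix.isHermitian_one _)).pow 2

/-- The partition function is largest when there is no field. -/
theorem partitionFunction_hamiltonian_le (hM : Even M) (hN : Even N) (d : ℕ) {β : ℝ}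
    (hβ : 0 < β) (b : Box M N → ℝ) :
    partitionFunction β (hamiltonian d b) ≤ partitionFunction β (hamiltonian₀ M N d) := by
  classical
  set Z : (Box M N → ℝ) → ℝ := fun f => partitionFunction β (hamiltonian d f) with hZ
  have hZpos : ∀ f, 0 < Z f := fun f => partitionFunction_pos (isHermitian_hamiltonian d f) β
  -- The reflected fields take values in `0`, `f` and `-f`, so a set closed under negation and
  -- containing `0` confines the maximization to finitely many fields.
  set S : Set ℝ := {0} ∪ Set.range b ∪ Set.range (-b) with hS
  have hSfin : S.Finite := ((Set.finite_singleton _).union (Set.finite_range _)).union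
    (Set.finite_range _)
  have hS0 : (0 : ℝ) ∈ S := Or.inl (Or.inl rfl)
  have hSneg : ∀ r ∈ S, -r ∈ S := by
    rintro r ((hr | ⟨x, rfl⟩) | ⟨x, rfl⟩)
    · rw [Set.mem_singleton_iff.1 hr, neg_zero]
      exact hS0
    · exact Or.inr ⟨x, rfl⟩
    · exact Or.inl (Or.inr ⟨x, by simp⟩)
  set 𝓕 : Set (Box M N → ℝ) := {f | ∀ x, f x ∈ S} with h𝓕
  have hfin : 𝓕.Finite := (Set.Finite.pi fun _ => hSfin).subset fun f hf x _ => hf x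
  have hb : b ∈ 𝓕 := fun x => Or.inl (Or.inr ⟨x, rfl⟩)
  obtain ⟨g, hg, hmax⟩ := hfin.exists_maximalFor Z 𝓕 ⟨b, hb⟩
  have hmax' : ∀ f ∈ 𝓕, Z f ≤ Z g := fun f hf => by
    by_contra! hlt
    exact absurd (hmax hf hlt.le) (not_le.2 hlt)
  set zeros : (Box M N → ℝ) → ℕ := fun f => ∑ x, if f x = 0 then 1 else 0 with hzeros
  obtain ⟨f, ⟨hf, hfg⟩, hfmax⟩ := (hfin.subset
    (Set.sep_subset 𝓕 fun f => Z f = Z g)).exists_maximalFor zeros _ ⟨g, hg, rfl⟩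
  have hfmax' : ∀ h ∈ 𝓕, Z h = Z g → zeros h ≤ zeros f := fun h hh hhg => by
    by_contra! hlt
    exact absurd (hfmax ⟨hh, hhg⟩ hlt.le) (not_le.2 hlt)
  have hf0 : f = 0 := by
    by_contra hne
    obtain ⟨x, hx⟩ := Function.ne_iff.1 hne
    -- The reflection is chosen to cut the box `x`, so that both new fields vanish there.
    set θ := reflBox hM hN x.1.1 with hθ
    set w := halfWeight hM hN x.1.1 with hw
    have hθx : θ x = x := (reflBox_eq_iff hM hN _ _).2 (by ring)
    set f₁ : Box M N → ℝ := fun y => w y * f y - w (θ y) * f (θ y) with hf₁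
    set f₂ : Box M N → ℝ := fun y => w (θ y) * f y - w y * f (θ y) with hf₂
    have hval : ∀ y, (θ y = y ∧ f₁ y = 0 ∧ f₂ y = 0) ∨ (f₁ y = f y ∧ f₂ y = - f (θ y)) ∨
        (f₁ y = - f (θ y) ∧ f₂ y = f y) := by
      intro y
      have hsum : w y + w (θ y) = 1 := halfWeight_add_reflBox hM hN x.1.1 y
      by_cases hy : θ y = y
      · refine Or.inl ⟨hy, ?_, ?_⟩ <;> simp [hf₁, hf₂, hy]
      · have hwy : w y = if IsFirstHalf x.1.1 y.1 then 1 else 0 := if_neg hy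
        by_cases hc : IsFirstHalf x.1.1 y.1
        · rw [if_pos hc] at hwy
          have : w (θ y) = 0 := by linarith
          refine Or.inr (Or.inl ?_)
          simp [hf₁, hf₂, hwy, this]
        · rw [if_neg hc] at hwy
          have : w (θ y) = 1 := by linarith
          refine Or.inr (Or.inr ?_)
          simp [hf₁, hf₂, hwy, this]
    have h₁ : f₁ ∈ 𝓕 := fun y => by
      rcases hval y with ⟨-, h, -⟩ | ⟨h, -⟩ | ⟨h, -⟩ <;> rw [h]
      exacts [hS0, hf y, hSneg _ (hf _)]
    have h₂ : f₂ ∈ 𝓕 := fun y => by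
      rcases hval y with ⟨-, -, h⟩ | ⟨-, h⟩ | ⟨-, h⟩ <;> rw [h]
      exacts [hS0, hSneg _ (hf _), hf y]
    have hrefl : Z f ^ 2 ≤ Z f₁ * Z f₂ :=
      partitionFunction_hamiltonian_sq_le hM hN x.1.1 d hβ.le f
    have hZ₁ := hmax' _ h₁
    have hZ₂ := hmax' _ h₂
    rw [hfg] at hrefl
    -- `(Z g)² ≤ Z f₁ * Z f₂` with both factors at most `Z g` forces equality.
    have e₁ : Z f₁ = Z g := by
      refine le_antisymm hZ₁ ?_
      nlinarith [hZpos f₁, hZpos f₂, hZpos g]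
    have e₂ : Z f₂ = Z g := by
      refine le_antisymm hZ₂ ?_
      nlinarith [hZpos f₁, hZpos f₂, hZpos g]
    have hz₁ := hfmax' _ h₁ e₁
    have hz₂ := hfmax' _ h₂ e₂
    have hperm : zeros f = ∑ y, if f (θ y) = 0 then 1 else 0 :=
      (Equiv.sum_comp (reflBox_involutive hM hN x.1.1).toPerm
        fun y => if f y = 0 then (1 : ℕ) else 0).symm
    -- On an uncut box, `f₁ y` and `f₂ y` are `f y` and `-f (θ y)` in some order, so no zero is
    -- lost; on a cut box both vanish, a strict gain at `x`.
    have hlt : ∑ y, ((if f y = 0 then 1 else 0) + if f (θ y) = 0 then 1 else 0) <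
        ∑ y, ((if f₁ y = 0 then 1 else 0) + if f₂ y = 0 then 1 else 0) := by
      refine Finset.sum_lt_sum (fun y _ => ?_) ⟨x, Finset.mem_univ _, ?_⟩
      · rcases hval y with ⟨h1, h2, h3⟩ | ⟨h2, h3⟩ | ⟨h2, h3⟩
        · rw [h1, h2, h3]
          by_cases h0 : f y = 0 <;> simp [h0]
        · rw [h2, h3]
          simp
        · rw [h2, h3, add_comm]
          simp
      · have hx1 : f₁ x = 0 := by simp [hf₁, hθx]
        have hx2 : f₂ x = 0 := by simp [hf₂, hθx]
        have hx' : f x ≠ 0 := hx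
        rw [hθx, hx1, hx2]
        simp [hx']
    rw [Finset.sum_add_distrib, Finset.sum_add_distrib, ← hperm] at hlt
    change zeros f + zeros f < zeros f₁ + zeros f₂ at hlt
    omega
  have := hmax' b hb
  rw [← hfg, hf0] at this
  exact this

end Lattice

/-! ### Sums over boxes -/

section Boxes

variable {M N : ℕ} [NeZero M] [NeZero N]

lemma sum_box_translate (hM : Even M) (hN : Even N) {R : Type*} [AddCommMonoid R]
    (f : Site M N → R) (v : Site M N) :
    ∑ x : Box M N, f (x.1 + v) = ∑ q : Site M N,
      if ZMod.castHom hM.two_dvd (ZMod 2) q.1 + ZMod.castHom hN.two_dvd (ZMod 2) q.2 =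
        ZMod.castHom hM.two_dvd (ZMod 2) v.1 + ZMod.castHom hN.two_dvd (ZMod 2) v.2
      then f q else 0 := by
  rw [← Finset.sum_subtype (Finset.univ.filter fun p : Site M N => Even (p.1.val + p.2.val))
    (by simp) fun p => f (p + v), Finset.sum_filter]
  refine Eq.trans ?_ (Equiv.sum_comp (Equiv.addRight v) _)
  refine Finset.sum_congr rfl fun p _ => ?_
  have : Even (p.1.val + p.2.val) ↔
      ZMod.castHom hM.two_dvd (ZMod 2) (p + v).1 + ZMod.castHom hN.two_dvd (ZMod 2) (p + v).2 =
        ZMod.castHom hM.two_dvd (ZMod 2) v.1 + ZMod.castHom hN.two_dvd (ZMod 2) v.2 := by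
    rw [even_val_add_val_iff hM.two_dvd hN.two_dvd, Prod.fst_add, Prod.snd_add, map_add, map_add,
      add_add_add_comm, add_eq_right]
  exact if_congr this rfl rfl

/-- Every site lies in exactly two boxes. -/
lemma sum_box_corners (hM : Even M) (hN : Even N) {R : Type*} [AddCommMonoid R]
    (f : Site M N → R) :
    ∑ x : Box M N, (f (x.1.1, x.1.2) + f (x.1.1 + 1, x.1.2) + f (x.1.1, x.1.2 + 1) +
      f (x.1.1 + 1, x.1.2 + 1)) = 2 • ∑ i, f i := by
  have h00 := sum_box_translate hM hN f (0, 0)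
  have h10 := sum_box_translate hM hN f (1, 0)
  have h01 := sum_box_translate hM hN f (0, 1)
  have h11 := sum_box_translate hM hN f (1, 1)
  simp only [Prod.add_def, add_zero] at h00 h10 h01 h11
  rw [Finset.sum_add_distrib, Finset.sum_add_distrib, Finset.sum_add_distrib, h00, h10, h01, h11,
    ← Finset.sum_add_distrib, ← Finset.sum_add_distrib, ← Finset.sum_add_distrib,
    Finset.smul_sum]
  refine Finset.sum_congr rfl fun q _ => ?_
  simp only [map_zero, map_one, add_zero, zero_add, show (1 + 1 : ZMod 2) = 0 from rfl]
  -- Only the parity of the site matters: an even site is the lower left and the upper right corner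
  -- of a box, an odd one the lower right and the upper left.
  generalize ZMod.castHom hM.two_dvd (ZMod 2) q.1 + ZMod.castHom hN.two_dvd (ZMod 2) q.2 = r
  have hr : r = 0 ∨ r = 1 := by
    revert r
    decide
  rcases hr with rfl | rfl <;> simp [two_smul]

lemma sum_boxOp (hM : Even M) (hN : Even N) {d : ℕ} (A : Matrix (Fin (d + 1)) (Fin (d + 1)) ℂ) :
    ∑ x : Box M N, boxOp A x = (2 : ℂ) • totalOp M N A := by
  rw [two_smul, ← two_nsmul]
  exact sum_box_corners hM hN (siteOp A)

lemma card_box (hM : Even M) (hN : Even N) :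
    2 * Fintype.card (Box M N) = Fintype.card (Site M N) := by
  have := sum_box_corners hM hN (fun _ : Site M N => 1)
  simp only [Finset.sum_const, Finset.card_univ, smul_eq_mul] at this
  omega

variable (d : ℕ)

lemma hamiltonian_eq (b : Box M N → ℝ) :
    hamiltonian d b = hamiltonian₀ M N d - ∑ x, (b x : ℂ) • boxOp (spin3 d) x +
      ((1 / 2 * ∑ x, b x ^ 2 : ℝ) : ℂ) • 1 := by
  have hsq : ∀ x, (boxOp (spin3 d) x - ((b x : ℝ) : ℂ) • (1 : Matrix (Config M N d) _ ℂ)) ^ 2 =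
      boxOp (spin3 d) x ^ 2 - (2 : ℂ) • ((b x : ℂ) • boxOp (spin3 d) x) +
        ((b x ^ 2 : ℝ) : ℂ) • 1 := by
    intro x
    rw [sq, sub_mul, mul_sub, mul_sub, sq]
    simp only [Matrix.smul_mul, Matrix.mul_smul, Matrix.one_mul, Matrix.mul_one, smul_smul,
      Complex.ofReal_mul, sq, two_mul, add_smul]
    abel
  rw [hamiltonian₀, hamiltonian, hamiltonian]
  simp only [hsq, Pi.zero_apply, Complex.ofReal_zero, zero_smul, sub_zero]
  have h1 : ∀ x : Box M N, boxOp (spin1 d) x ^ 2 + boxOp (spin2 d) x ^ 2 +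
      (boxOp (spin3 d) x ^ 2 - (2 : ℂ) • ((b x : ℂ) • boxOp (spin3 d) x) +
        ((b x ^ 2 : ℝ) : ℂ) • (1 : Matrix (Config M N d) _ ℂ)) =
      (boxOp (spin1 d) x ^ 2 + boxOp (spin2 d) x ^ 2 + boxOp (spin3 d) x ^ 2) -
        (2 : ℂ) • ((b x : ℂ) • boxOp (spin3 d) x) +
        ((b x ^ 2 : ℝ) : ℂ) • (1 : Matrix (Config M N d) _ ℂ) := by
    intro x
    abel
  rw [Finset.sum_congr rfl fun x _ => h1 x, Finset.sum_add_distrib, Finset.sum_sub_distrib,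
    ← Finset.smul_sum, smul_add, smul_sub, smul_smul, ← Finset.sum_smul, smul_smul]
  simp

/-- The box field is `B / 2` because every site lies in two boxes; the constant is `1/2 · Λ/2 ·
(B/2)²`. -/
lemma hamiltonian_const (hM : Even M) (hN : Even N) (B : ℝ) :
    hamiltonian d (fun _ : Box M N => B / 2) = homogeneousField M N d B +
      (((Fintype.card (Site M N) : ℝ) / 16 * B ^ 2 : ℝ) : ℂ) • 1 := by
  rw [hamiltonian_eq, ← Finset.smul_sum, sum_boxOp hM hN, smul_smul, homogeneousField,
    ← card_box hM hN, Finset.sum_const, Finset.card_univ]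
  congr 3
  · push_cast
    ring_nf
  · push_cast
    ring

lemma hamiltonian_single (x : Box M N) (b : ℝ) :
    hamiltonian d (Pi.single x b) = singleBoxField d x b + ((1 / 2 * b ^ 2 : ℝ) : ℂ) • 1 := by
  rw [hamiltonian_eq, singleBoxField, Finset.sum_eq_single x, Finset.sum_eq_single x,
    Pi.single_eq_same]
  · intro y _ hy
    simp [hy]
  · simp
  · intro y _ hy
    simp [hy]
  · simp

lemma isHermitian_totalOp {A : Matrix (Fin (d + 1)) (Fin (d + 1)) ℂ} (hA : A.IsHermitian) :
    (totalOp M N A).IsHermitian := by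
  rw [Matrix.IsHermitian, totalOp, Matrix.conjTranspose_sum]
  exact Finset.sum_congr rfl fun i _ => isHermitian_siteOp hA i

lemma isHermitian_homogeneousField (B : ℝ) : (homogeneousField M N d B).IsHermitian :=
  (isHermitian_hamiltonian d _).sub
    (isHermitian_ofReal_smul (isHermitian_totalOp d (isHermitian_spin3 d)) B)

lemma isHermitian_singleBoxField (x : Box M N) (b : ℝ) : (singleBoxField d x b).IsHermitian :=
  (isHermitian_hamiltonian d _).sub
    (isHermitian_ofReal_smul (isHermitian_boxOp (isHermitian_spin3 d) x) b)

lemma homogeneousField_zero : homogeneousField M N d 0 = hamiltonian₀ M N d := by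
  simp [homogeneousField]

lemma singleBoxField_zero (x : Box M N) : singleBoxField d x 0 = hamiltonian₀ M N d := by
  simp [singleBoxField]

/-! ### Bounds on energies in external fields -/

theorem groundEnergy_hamiltonian₀_le (hM : Even M) (hN : Even N) (b : Box M N → ℝ) :
    groundEnergy (hamiltonian₀ M N d) ≤ groundEnergy (hamiltonian d b) :=
  groundEnergy_le_of_partitionFunction_le (isHermitian_hamiltonian d _)
    (isHermitian_hamiltonian d b) fun _ hβ => partitionFunction_hamiltonian_le hM hN d hβ b

lemma freeEnergy_hamiltonian₀_le (hM : Even M) (hN : Even N) {β : ℝ} (hβ : 0 < β)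
    (b : Box M N → ℝ) : freeEnergy β (hamiltonian₀ M N d) ≤ freeEnergy β (hamiltonian d b) :=
  freeEnergy_le_of_partitionFunction_le (isHermitian_hamiltonian d b) hβ
    (partitionFunction_hamiltonian_le hM hN d hβ b)

lemma groundEnergy_homogeneousField_ge (hM : Even M) (hN : Even N) (B : ℝ) :
    groundEnergy (hamiltonian₀ M N d) ≤ groundEnergy (homogeneousField M N d B) +
      (Fintype.card (Site M N) : ℝ) / 16 * B ^ 2 := by
  rw [← groundEnergy_add_smul_one (isHermitian_homogeneousField d B), ← hamiltonian_const d hM hN]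
  exact groundEnergy_hamiltonian₀_le d hM hN _

lemma freeEnergy_homogeneousField_ge (hM : Even M) (hN : Even N) {β : ℝ} (hβ : 0 < β) (B : ℝ) :
    freeEnergy β (hamiltonian₀ M N d) ≤ freeEnergy β (homogeneousField M N d B) +
      (Fintype.card (Site M N) : ℝ) / 16 * B ^ 2 := by
  rw [← freeEnergy_add_smul_one (isHermitian_homogeneousField d B) hβ.ne',
    ← hamiltonian_const d hM hN]
  exact freeEnergy_hamiltonian₀_le d hM hN hβ _

lemma groundEnergy_singleBoxField_ge (hM : Even M) (hN : Even N) (x : Box M N) (b : ℝ) :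
    groundEnergy (hamiltonian₀ M N d) ≤ groundEnergy (singleBoxField d x b) + 1 / 2 * b ^ 2 := by
  rw [← groundEnergy_add_smul_one (isHermitian_singleBoxField d x b), ← hamiltonian_single]
  exact groundEnergy_hamiltonian₀_le d hM hN _

lemma freeEnergy_singleBoxField_ge (hM : Even M) (hN : Even N) {β : ℝ} (hβ : 0 < β) (x : Box M N)
    (b : ℝ) : freeEnergy β (hamiltonian₀ M N d) ≤
      freeEnergy β (singleBoxField d x b) + 1 / 2 * b ^ 2 := by
  rw [← freeEnergy_add_smul_one (isHermitian_singleBoxField d x b) hβ.ne', ← hamiltonian_single]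
  exact freeEnergy_hamiltonian₀_le d hM hN hβ _

/-! ### Magnetization of ground states -/

lemma re_dotProduct_singleBoxField {x : Box M N} {ψ : Config M N d → ℂ}
    (hψ : IsGroundState (hamiltonian₀ M N d) ψ) (b : ℝ) :
    (star ψ ⬝ᵥ (singleBoxField d x b *ᵥ ψ)).re =
      groundEnergy (hamiltonian₀ M N d) * (star ψ ⬝ᵥ ψ).re -
        b * (star ψ ⬝ᵥ (boxOp (spin3 d) x *ᵥ ψ)).re := by
  rw [singleBoxField, Matrix.sub_mulVec, hψ.2, Matrix.smul_mulVec, dotProduct_sub,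
    dotProduct_smul, dotProduct_smul, Complex.sub_re, smul_eq_mul, smul_eq_mul,
    Complex.re_ofReal_mul, Complex.re_ofReal_mul]

/-- With `ψ` as trial state in the field `b`, the linear gain `b s` is bounded by the quadratic term
`b² ‖ψ‖² / 2` for every `b`, hence `s = 0`. -/
theorem dotProduct_boxOp_eq_zero (hM : Even M) (hN : Even N) {ψ : Config M N d → ℂ}
    (hψ : IsGroundState (hamiltonian₀ M N d) ψ) (x : Box M N) :
    star ψ ⬝ᵥ (boxOp (spin3 d) x *ᵥ ψ) = 0 := by
  set s := star ψ ⬝ᵥ (boxOp (spin3 d) x *ᵥ ψ) with hs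
  have him : s.im = 0 :=
    (isHermitian_boxOp (isHermitian_spin3 d) x).im_star_dotProduct_mulVec_self ψ
  refine Complex.ext ?_ him
  rw [Complex.zero_re]
  set m := (star ψ ⬝ᵥ ψ).re with hm
  have hpos : 0 < m := re_dotProduct_star_self_pos hψ.1
  have key : ∀ b : ℝ, b * s.re ≤ 1 / 2 * b ^ 2 * m := by
    intro b
    have h1 := groundEnergy_mul_le (isHermitian_singleBoxField d x b) ψ
    rw [re_dotProduct_singleBoxField d hψ] at h1
    have h2 := mul_le_mul_of_nonneg_right (groundEnergy_singleBoxField_ge d hM hN x b) hpos.le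
    rw [add_mul] at h2
    linarith
  -- This `b` maximizes `b s - b² m / 2`.
  have h := key (s.re / m)
  rw [show s.re / m * s.re = s.re ^ 2 / m by ring,
    show 1 / 2 * (s.re / m) ^ 2 * m = 1 / 2 * (s.re ^ 2 / m) by field_simp] at h
  have h' : s.re ^ 2 / m ≤ 0 := by linarith
  have h'' : s.re ^ 2 ≤ 0 := by
    by_contra! hlt
    exact absurd (div_pos hlt hpos) (not_lt.2 h')
  exact pow_eq_zero_iff two_ne_zero |>.1 (le_antisymm h'' (sq_nonneg _))

theorem dotProduct_totalOp_eq_zero (hM : Even M) (hN : Even N) {ψ : Config M N d → ℂ}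
    (hψ : IsGroundState (hamiltonian₀ M N d) ψ) :
    star ψ ⬝ᵥ (totalOp M N (spin3 d) *ᵥ ψ) = 0 := by
  have h : (2 : ℂ) • (star ψ ⬝ᵥ (totalOp M N (spin3 d) *ᵥ ψ)) = 0 := by
    rw [← dotProduct_smul, ← Matrix.smul_mulVec, ← sum_boxOp hM hN, Matrix.sum_mulVec,
      dotProduct_sum]
    exact Finset.sum_eq_zero fun x _ => dotProduct_boxOp_eq_zero d hM hN hψ x
  simpa using h

/-- A zero-field ground state is a trial state on which the field term has expectation zero. With
the quadratic lower bound this pins the derivative at `b = 0`, even where the ground energy is not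
known to be smooth. -/
lemma groundEnergy_singleBoxField_le (hM : Even M) (hN : Even N) (x : Box M N) (b : ℝ) :
    groundEnergy (singleBoxField d x b) ≤ groundEnergy (hamiltonian₀ M N d) := by
  obtain ⟨ψ, hψ⟩ := exists_isGroundState (isHermitian_hamiltonian (M := M) (N := N) d 0)
  have h := groundEnergy_mul_le (isHermitian_singleBoxField d x b) ψ
  rw [re_dotProduct_singleBoxField d hψ, dotProduct_boxOp_eq_zero d hM hN hψ, Complex.zero_re,
    mul_zero, sub_zero] at h
  exact le_of_mul_le_mul_right h (re_dotProduct_star_self_pos hψ.1)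

end Boxes

/-! ### Conservation of the total magnetization -/

section Conservation

variable {M N : ℕ} [NeZero M] [NeZero N] (d : ℕ)

/-- The total magnetization of a configuration. -/
def magnetization (σ : Config M N d) : ℝ := ∑ i, ((d : ℝ) / 2 - ((σ i : ℕ) : ℝ))

lemma totalOp_spin3 :
    totalOp M N (spin3 d) = Matrix.diagonal fun σ => (magnetization d σ : ℂ) := by
  ext σ τ
  simp only [totalOp, siteOp_eq_localOp, spin3, localOp_diagonal, Matrix.sum_apply]
  by_cases h : σ = τ
  · subst h
    simp [magnetization]
  · simp [h]

lemma totalOp_mul_boxOp_spinRaise (x : Box M N) :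
    totalOp M N (spin3 d) * boxOp (spinRaise d) x =
      boxOp (spinRaise d) x * totalOp M N (spin3 d) + boxOp (spinRaise d) x := by
  have h : ∀ i : Site M N, totalOp M N (spin3 d) * siteOp (spinRaise d) i =
      siteOp (spinRaise d) i * totalOp M N (spin3 d) + siteOp (spinRaise d) i := by
    intro i
    ext σ τ
    rw [totalOp_spin3, Matrix.add_apply, Matrix.diagonal_mul, Matrix.mul_diagonal, siteOp]
    split_ifs with hoff
    · rw [spinRaise]
      split_ifs with hi
      -- The index counts down from the top weight, so the row index, smaller by one, has
      -- magnetization larger by one.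
      · have : magnetization d σ - magnetization d τ = 1 := by
          rw [magnetization, magnetization, ← Finset.sum_sub_distrib, Finset.sum_eq_single i]
          · rw [← hi]
            push_cast
            ring
          · intro j _ hj
            rw [hoff j hj, sub_self]
          · simp
        rw [sub_eq_iff_eq_add'.1 this]
        push_cast
        ring
      · simp
    · simp
  simp only [boxOp, Matrix.mul_add, Matrix.add_mul, h]
  abel

lemma boxOp_add (A B : Matrix (Fin (d + 1)) (Fin (d + 1)) ℂ) (x : Box M N) :
    boxOp (A + B) x = boxOp A x + boxOp B x := by
  simp only [boxOp, siteOp_eq_localOp, localOp_add]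
  abel

lemma boxOp_smul (c : ℂ) (A : Matrix (Fin (d + 1)) (Fin (d + 1)) ℂ) (x : Box M N) :
    boxOp (c • A) x = c • boxOp A x := by
  simp only [boxOp, siteOp_eq_localOp, localOp_smul, smul_add]

lemma boxOp_conjTranspose (A : Matrix (Fin (d + 1)) (Fin (d + 1)) ℂ) (x : Box M N) :
    (boxOp A x)ᴴ = boxOp Aᴴ x := by
  simp only [boxOp, siteOp_eq_localOp, Matrix.conjTranspose_add, localOp_conjTranspose]

/-- Each product contains one raising and one lowering factor, so it visibly conserves the total
magnetization. -/
lemma boxOp_spin1_sq_add_spin2_sq (x : Box M N) :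
    boxOp (spin1 d) x ^ 2 + boxOp (spin2 d) x ^ 2 =
      (1 / 2 : ℂ) • (boxOp (spinRaise d) x * (boxOp (spinRaise d) x)ᴴ +
        (boxOp (spinRaise d) x)ᴴ * boxOp (spinRaise d) x) := by
  have h2 : spinRaise d - (spinRaise d)ᴴ = spinRaise d + (-1 : ℂ) • (spinRaise d)ᴴ := by
    rw [neg_one_smul, sub_eq_add_neg]
  rw [spin1, spin2, h2, boxOp_smul, boxOp_smul, boxOp_add, boxOp_add, boxOp_smul,
    ← boxOp_conjTranspose, smul_pow, smul_pow]
  set R := boxOp (spinRaise d) x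
  have e1 : (1 / (2 * Complex.I)) ^ 2 = -(1 / 4 : ℂ) := by
    rw [div_pow, mul_pow, Complex.I_sq]
    norm_num
  rw [e1, neg_one_smul, ← sub_eq_add_neg, sq (R + Rᴴ), sq (R - Rᴴ), neg_smul, ← sub_eq_add_neg,
    show ((1 / 2 : ℂ) ^ 2) = 1 / 4 by norm_num, ← smul_sub,
    show (1 / 2 : ℂ) = 1 / 4 * 2 by norm_num, mul_smul, two_smul]
  congr 1
  noncomm_ring

lemma commute_totalOp_hamiltonian₀ :
    Commute (totalOp M N (spin3 d)) (hamiltonian₀ M N d) := by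
  rw [hamiltonian₀, hamiltonian]
  refine Commute.smul_right (Commute.sum_right _ _ _ fun x _ => ?_) _
  have hR := totalOp_mul_boxOp_spinRaise d x
  have hL : totalOp M N (spin3 d) * (boxOp (spinRaise d) x)ᴴ =
      (boxOp (spinRaise d) x)ᴴ * totalOp M N (spin3 d) - (boxOp (spinRaise d) x)ᴴ := by
    have := congrArg Matrix.conjTranspose hR
    rw [Matrix.conjTranspose_mul, Matrix.conjTranspose_add, Matrix.conjTranspose_mul,
      isHermitian_totalOp d (isHermitian_spin3 d)] at this
    rw [this, add_sub_cancel_right]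
  have h3 : Commute (totalOp M N (spin3 d)) (boxOp (spin3 d) x) := by
    have hd : ∃ f, boxOp (spin3 d) x = Matrix.diagonal f := by
      simp only [boxOp, siteOp_eq_localOp, spin3, localOp_diagonal, Matrix.diagonal_add]
      exact ⟨_, rfl⟩
    obtain ⟨f, hf⟩ := hd
    rw [hf, totalOp_spin3]
    exact Matrix.commute_diagonal _ _
  refine Commute.add_right ?_ ?_
  · rw [boxOp_spin1_sq_add_spin2_sq]
    refine Commute.smul_right (Commute.add_right ?_ ?_) _
    · rw [Commute, SemiconjBy, ← Matrix.mul_assoc, hR, Matrix.add_mul, Matrix.mul_assoc, hL,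
        Matrix.mul_sub, Matrix.mul_assoc]
      abel
    · rw [Commute, SemiconjBy, ← Matrix.mul_assoc, hL, Matrix.sub_mul, Matrix.mul_assoc, hR,
        Matrix.mul_add, Matrix.mul_assoc]
      abel
  · simp only [Pi.zero_apply, Complex.ofReal_zero, zero_smul, sub_zero]
    exact h3.pow_right 2

end Conservation

/-! ### Ground energies in the sectors of a conserved quantity -/

section Sectors

variable {ι : Type*} [Fintype ι] [DecidableEq ι] {H : Matrix ι ι ℂ} {D : ι → ℝ}

/-- An eigenvector of `H - B D`, where the diagonal matrix `D` commutes with `H`, has a component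
that is a joint eigenvector. -/
lemma exists_joint_eigenvector (hD : Commute (Matrix.diagonal fun i => (D i : ℂ)) H) {B e : ℝ}
    {ψ : ι → ℂ} (hψ : ψ ≠ 0)
    (h : (H - (B : ℂ) • Matrix.diagonal fun i => (D i : ℂ)) *ᵥ ψ = (e : ℂ) • ψ) :
    ∃ (k : ι) (φ : ι → ℂ), φ ≠ 0 ∧ (Matrix.diagonal fun i => (D i : ℂ)) *ᵥ φ = (D k : ℂ) • φ ∧
      H *ᵥ φ = ((e + B * D k : ℝ) : ℂ) • φ := by
  obtain ⟨k, hk⟩ := Function.ne_iff.1 hψ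
  -- By commutation `H` is block diagonal for the values of `D`, so cutting `ψ` down to the block of
  -- an index `k` with `ψ k ≠ 0` leaves an eigenvector.
  have hHD : ∀ i j, D i ≠ D j → H i j = 0 := by
    intro i j hij
    have := congrFun (congrFun hD.eq i) j
    rw [Matrix.diagonal_mul, Matrix.mul_diagonal, mul_comm (H i j)] at this
    by_contra hne
    exact hij (Complex.ofReal_injective (mul_right_cancel₀ hne this))
  refine ⟨k, fun i => if D i = D k then ψ i else 0, ?_, ?_, ?_⟩
  · intro h0
    have := congrFun h0 k
    simp only [if_true, Pi.zero_apply] at this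
    exact hk this
  · ext i
    rw [Matrix.mulVec_diagonal, Pi.smul_apply, smul_eq_mul]
    by_cases hi : D i = D k <;> simp [hi]
  · ext i
    have hi := congrFun h i
    rw [Matrix.sub_mulVec, Matrix.smul_mulVec, Pi.sub_apply, Pi.smul_apply,
      Matrix.mulVec_diagonal, Pi.smul_apply, smul_eq_mul, smul_eq_mul, sub_eq_iff_eq_add] at hi
    rw [Pi.smul_apply, smul_eq_mul]
    by_cases hik : D i = D k
    · have : (H *ᵥ fun i => if D i = D k then ψ i else 0) i = (H *ᵥ ψ) i := by
        refine Finset.sum_congr rfl fun j _ => ?_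
        by_cases hj : D j = D k
        · simp [hj]
        · simp only
          rw [hHD i j fun hij => hj (hij ▸ hik), zero_mul, zero_mul]
      rw [this, hi, if_pos hik, hik]
      push_cast
      ring
    · rw [if_neg hik, mul_zero]
      refine Finset.sum_eq_zero fun j _ => ?_
      by_cases hj : D j = D k
      · simp only
        rw [hHD i j fun hij => hik (hij.trans hj), zero_mul]
      · simp [hj]

/-- The ground energy does not depend on a small field that couples to a conserved quantity which
vanishes in all ground states. -/
lemma eventually_groundEnergy_eq [Nonempty ι] (hH : H.IsHermitian)
    (hD : Commute (Matrix.diagonal fun i => (D i : ℂ)) H)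
    (h0 : ∀ ψ, IsGroundState H ψ →
      star ψ ⬝ᵥ ((Matrix.diagonal fun i => (D i : ℂ)) *ᵥ ψ) = 0) :
    ∀ᶠ B : ℝ in 𝓝 0, groundEnergy (H - (B : ℂ) • Matrix.diagonal fun i => (D i : ℂ)) =
      groundEnergy H := by
  have hdiag : (Matrix.diagonal fun i => (D i : ℂ)).IsHermitian := by
    rw [Matrix.IsHermitian, Matrix.diagonal_conjTranspose]
    congr 1
    ext i
    simp
  have hHB : ∀ B : ℝ, (H - (B : ℂ) • Matrix.diagonal fun i => (D i : ℂ)).IsHermitian := fun B =>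
    hH.sub (isHermitian_ofReal_smul hdiag B)
  have hzero : ∀ (k : ι) (φ : ι → ℂ), IsGroundState H φ →
      (Matrix.diagonal fun i => (D i : ℂ)) *ᵥ φ = (D k : ℂ) • φ → D k = 0 := by
    intro k φ hφ hk
    have h := h0 φ hφ
    rw [hk, dotProduct_smul, smul_eq_mul, mul_eq_zero] at h
    rcases h with h | h
    · exact_mod_cast h
    · have := re_dotProduct_star_self_pos hφ.1
      rw [h, Complex.zero_re] at this
      exact absurd this (lt_irrefl _)
  obtain ⟨δ, hδ, hgap⟩ := exists_gap hH
  obtain ⟨ψ₀, hψ₀⟩ := exists_isGroundState hH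
  obtain ⟨k₀, φ₀, hφ₀, hDφ₀, hHφ₀⟩ := exists_joint_eigenvector (B := 0) (e := groundEnergy H) hD
    hψ₀.1 (by simpa using hψ₀.2)
  rw [zero_mul, add_zero] at hHφ₀
  have hk₀ := hzero k₀ φ₀ ⟨hφ₀, hHφ₀⟩ hDφ₀
  -- For such `B` no sector gains enough from the field to bring an excited level below the ground
  -- energy.
  have hsmall : ∀ᶠ B : ℝ in 𝓝 0, ∀ k, B * D k < δ := by
    rw [Filter.eventually_all]
    intro k
    have : ContinuousAt (fun B : ℝ => B * D k) 0 := by fun_prop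
    refine this.eventually_lt continuousAt_const ?_
    simpa using hδ
  filter_upwards [hsmall] with B hB
  apply le_antisymm
  · refine groundEnergy_le_of_mulVec_eq (hHB B) hφ₀ ?_
    rw [Matrix.sub_mulVec, Matrix.smul_mulVec, hDφ₀, hk₀, hHφ₀]
    simp
  · obtain ⟨ψ, hψ, hE⟩ := exists_isGroundState (hHB B)
    obtain ⟨k, φ, hφ, hDφ, hHφ⟩ := exists_joint_eigenvector hD hψ hE
    rcases hgap _ φ hφ hHφ with h | h
    · have := hzero k φ ⟨hφ, by rw [hHφ, h]⟩ hDφ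
      rw [this, mul_zero, add_zero] at h
      exact h.ge
    · have := hB k
      linarith

end Sectors

/-! ### Differentiability -/

section Calculus

/-- The function `g + c t²` has a minimum at `0`. A negative second derivative would make `0` a
local maximum as well, so the function would be locally constant, with second derivative zero. -/
lemma iteratedDeriv_two_ge {g : ℝ → ℝ} {c : ℝ} (hmin : ∀ t, g 0 ≤ g t + c * t ^ 2)
    (hd : ∀ᶠ t in 𝓝 (0 : ℝ), DifferentiableAt ℝ g t) (hdd : DifferentiableAt ℝ (deriv g) 0) :
    deriv g 0 = 0 ∧ -(2 * c) ≤ iteratedDeriv 2 g 0 := by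
  set f : ℝ → ℝ := fun t => g t + c * t ^ 2 with hf
  have hmin' : IsLocalMin f 0 := Filter.Eventually.of_forall fun t => by
    simpa [hf] using hmin t
  have hderiv : deriv f =ᶠ[𝓝 0] fun t => deriv g t + c * (2 * t) := by
    filter_upwards [hd] with t ht
    have := ht.hasDerivAt.add ((hasDerivAt_pow 2 t).const_mul c)
    change deriv (g + fun y => c * y ^ 2) t = _
    simpa using this.deriv
  have hg0 : deriv g 0 = 0 := by
    have := hmin'.deriv_eq_zero
    rw [hderiv.eq_of_nhds] at this
    simpa using this
  have hdd' : deriv (deriv f) 0 = iteratedDeriv 2 g 0 + 2 * c := by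
    rw [hderiv.deriv_eq, iteratedDeriv_succ, iteratedDeriv_one]
    have := hdd.hasDerivAt.add (((hasDerivAt_id (0 : ℝ)).const_mul 2).const_mul c)
    refine this.deriv.trans ?_
    ring
  refine ⟨hg0, ?_⟩
  by_contra! hlt
  have hneg : deriv (deriv f) 0 < 0 := by rw [hdd']; linarith
  have hcont : ContinuousAt f 0 := by
    have := hd.self_of_nhds.continuousAt
    fun_prop
  have hmax := isLocalMax_of_deriv_deriv_neg hneg hmin'.deriv_eq_zero hcont
  have hconst : f =ᶠ[𝓝 0] fun _ => f 0 := by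
    filter_upwards [hmin', hmax] with t h1 h2
    exact le_antisymm h2 h1
  have : deriv (deriv f) 0 = 0 := by
    rw [hconst.deriv.deriv_eq]
    simp
  linarith

open scoped Matrix.Norms.Operator in
lemma contDiff_freeEnergy {ι : Type*} [Fintype ι] [DecidableEq ι] [Nonempty ι] {H K : Matrix ι ι ℂ}
    (hH : H.IsHermitian) (hK : K.IsHermitian) (β : ℝ) :
    ContDiff ℝ 2 fun b : ℝ => freeEnergy β (H - (b : ℂ) • K) := by
  have hexp : ContDiff ℝ 2 (NormedSpace.exp : Matrix ι ι ℂ → Matrix ι ι ℂ) :=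
    AnalyticOnNhd.contDiff fun x _ => NormedSpace.exp_analytic (𝕂 := ℝ) x
  have htr : ContDiff ℝ 2 (fun A : Matrix ι ι ℂ => A.trace.re) :=
    (LinearMap.toContinuousLinearMap
      (Complex.reLm ∘ₗ Matrix.traceLinearMap ι ℝ ℂ : Matrix ι ι ℂ →ₗ[ℝ] ℝ)).contDiff
  have harg : ContDiff ℝ 2 fun b : ℝ => -(β : ℂ) • (H - (b : ℂ) • K) := by
    have hb : ContDiff ℝ 2 fun b : ℝ => (b : ℂ) := Complex.ofRealCLM.contDiff
    have hK : ContDiff ℝ 2 fun b : ℝ => (b : ℂ) • K := hb.smul (contDiff_const (c := K))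
    exact (contDiff_const (c := -(β : ℂ))).smul ((contDiff_const (c := H)).sub hK)
  have hZ : ContDiff ℝ 2 fun b : ℝ => partitionFunction β (H - (b : ℂ) • K) :=
    htr.comp (hexp.comp harg)
  exact contDiff_const.mul (hZ.log fun b =>
    (partitionFunction_pos (hH.sub (isHermitian_ofReal_smul hK b)) β).ne')

lemma hasDerivAt_zero_of_sq_bounds {g : ℝ → ℝ} {c : ℝ} (h1 : ∀ t, g 0 ≤ g t + c * t ^ 2)
    (h2 : ∀ t, g t ≤ g 0) : HasDerivAt g 0 0 := by
  have hO : (fun t => g t - g 0) =O[𝓝 0] fun t : ℝ => ‖t - 0‖ ^ 2 := by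
    refine Asymptotics.IsBigO.of_bound c (Filter.Eventually.of_forall fun t => ?_)
    rw [Real.norm_eq_abs, abs_of_nonpos (by linarith [h2 t]), sub_zero, norm_pow, norm_norm,
      Real.norm_eq_abs, sq_abs]
    linarith [h1 t]
  have := (hO.hasFDerivAt one_lt_two).hasDerivAt.add_const (g 0)
  simpa using this

end Calculus

end

end Pyrochlore

theorem mainTheorem3 (M N : ℕ) [NeZero M] [NeZero N] (hM : Even M) (hN : Even N) (d : ℕ) :
    -- ground-state energy with arbitrary box fields
    (∀ b : Box M N → ℝ, groundEnergy (hamiltonian d b) ≥ groundEnergy (hamiltonian₀ M N d)) ∧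
    -- partition function with arbitrary box fields
    (∀ β : ℝ, 0 < β → ∀ b : Box M N → ℝ,
      partitionFunction β (hamiltonian d b) ≤ partitionFunction β (hamiltonian₀ M N d)) ∧
    -- ground states without field have no magnetization
    (∀ ψ : Config M N d → ℂ, IsGroundState (hamiltonian₀ M N d) ψ →
      star ψ ⬝ᵥ (totalOp M N (spin3 d) *ᵥ ψ) = 0 ∧
      ∀ x : Box M N, star ψ ⬝ᵥ (boxOp (spin3 d) x *ᵥ ψ) = 0) ∧
    -- homogeneous field, ground state
    (∀ E : ℝ → ℝ, (∀ B, E B = groundEnergy (homogeneousField M N d B)) →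
      (∀ B, E B + (Fintype.card (Site M N) : ℝ) / 16 * B ^ 2 ≥ E 0) ∧
      ContDiffAt ℝ 2 E 0 ∧
      -(1 / (Fintype.card (Site M N) : ℝ)) * deriv E 0 = 0 ∧
      -(1 / (Fintype.card (Site M N) : ℝ)) * iteratedDeriv 2 E 0 ≤ 1 / 8) ∧
    -- homogeneous field, inverse temperature `β`
    (∀ β : ℝ, 0 < β →
      ∀ F : ℝ → ℝ, (∀ B, F B = freeEnergy β (homogeneousField M N d B)) →
      (∀ B, F B + (Fintype.card (Site M N) : ℝ) / 16 * B ^ 2 ≥ F 0) ∧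
      ContDiffAt ℝ 2 F 0 ∧
      -(1 / (Fintype.card (Site M N) : ℝ)) * deriv F 0 = 0 ∧
      -(1 / (Fintype.card (Site M N) : ℝ)) * iteratedDeriv 2 F 0 ≤ 1 / 8) ∧
    -- field on a single box (which has four sites), ground state
    (∀ x : Box M N, ∀ E : ℝ → ℝ, (∀ b, E b = groundEnergy (singleBoxField d x b)) →
      (∀ b, E b + 1 / 2 * b ^ 2 ≥ E 0) ∧
      HasDerivAt E 0 0 ∧
      ((∀ᶠ b in 𝓝 (0 : ℝ), DifferentiableAt ℝ E b) → DifferentiableAt ℝ (deriv E) 0 →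
        -(1 / 4) * iteratedDeriv 2 E 0 ≤ 1 / 4)) ∧
    -- field on a single box, inverse temperature `β`
    (∀ β : ℝ, 0 < β → ∀ x : Box M N,
      ∀ F : ℝ → ℝ, (∀ b, F b = freeEnergy β (singleBoxField d x b)) →
      (∀ b, F b + 1 / 2 * b ^ 2 ≥ F 0) ∧
      ContDiffAt ℝ 2 F 0 ∧
      -(1 / 4) * deriv F 0 = 0 ∧
      -(1 / 4) * iteratedDeriv 2 F 0 ≤ 1 / 4) := by
  have hcard : (0 : ℝ) < Fintype.card (Site M N) := by exact_mod_cast Fintype.card_pos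
  -- The second-order condition with `c = Λ / 16` gives `-r ≤ Λ / 8`; dividing by `Λ` gives the
  -- bound `1 / 8`.
  have hsusc : ∀ r : ℝ, -(2 * ((Fintype.card (Site M N) : ℝ) / 16)) ≤ r →
      -(1 / (Fintype.card (Site M N) : ℝ)) * r ≤ 1 / 8 := by
    intro r hr
    have := mul_le_mul_of_nonneg_left hr (one_div_pos.2 hcard).le
    have e : 1 / (Fintype.card (Site M N) : ℝ) * -(2 * ((Fintype.card (Site M N) : ℝ) / 16)) =
        -(1 / 8) := by
      field_simp
      norm_num
    linarith
  refine ⟨groundEnergy_hamiltonian₀_le d hM hN,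
    fun β hβ => partitionFunction_hamiltonian_le hM hN d hβ,
    fun ψ hψ => ⟨dotProduct_totalOp_eq_zero d hM hN hψ, dotProduct_boxOp_eq_zero d hM hN hψ⟩,
    fun E hE => ?_, fun β hβ F hF => ?_, fun x E hE => ?_, fun β hβ x F hF => ?_⟩
  -- Local constancy gives smoothness and makes both derivatives zero.
  · have hconst : E =ᶠ[𝓝 0] fun _ => groundEnergy (hamiltonian₀ M N d) := by
      have hcomm := commute_totalOp_hamiltonian₀ (M := M) (N := N) d
      rw [totalOp_spin3] at hcomm
      filter_upwards [eventually_groundEnergy_eq (isHermitian_hamiltonian d 0) hcomm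
        fun ψ hψ => totalOp_spin3 (M := M) (N := N) d ▸ dotProduct_totalOp_eq_zero d hM hN hψ]
        with B hB
      rw [hE, homogeneousField, totalOp_spin3]
      exact hB
    refine ⟨fun B => ?_, contDiffAt_const.congr_of_eventuallyEq hconst, ?_, ?_⟩
    · rw [hE, hE, homogeneousField_zero]
      exact groundEnergy_homogeneousField_ge d hM hN B
    · rw [hconst.deriv_eq]
      simp
    · rw [hconst.iteratedDeriv_eq]
      simp [iteratedDeriv_const]
  · have hF' : F = fun B => freeEnergy β (homogeneousField M N d B) := funext hF
    have hmin : ∀ B, F 0 ≤ F B + (Fintype.card (Site M N) : ℝ) / 16 * B ^ 2 := fun B => by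
      rw [hF, hF, homogeneousField_zero]
      exact freeEnergy_homogeneousField_ge d hM hN hβ B
    have hsmooth : ContDiff ℝ 2 F := hF' ▸ contDiff_freeEnergy (isHermitian_hamiltonian d 0)
      (isHermitian_totalOp d (isHermitian_spin3 d)) β
    obtain ⟨h1, h2⟩ := iteratedDeriv_two_ge hmin
      (Filter.Eventually.of_forall fun B => hsmooth.differentiable two_ne_zero B)
      (hsmooth.differentiable_deriv_two 0)
    exact ⟨hmin, hsmooth.contDiffAt, by rw [h1, mul_zero], hsusc _ h2⟩
  · have hmin : ∀ b, E 0 ≤ E b + 1 / 2 * b ^ 2 := fun b => by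
      rw [hE, hE, singleBoxField_zero]
      exact groundEnergy_singleBoxField_ge d hM hN x b
    refine ⟨hmin, hasDerivAt_zero_of_sq_bounds hmin fun b => ?_, fun hd hdd => ?_⟩
    · rw [hE, hE, singleBoxField_zero]
      exact groundEnergy_singleBoxField_le d hM hN x b
    · have := (iteratedDeriv_two_ge hmin hd hdd).2
      linarith
  · have hF' : F = fun b => freeEnergy β (singleBoxField d x b) := funext hF
    have hmin : ∀ b, F 0 ≤ F b + 1 / 2 * b ^ 2 := fun b => by
      rw [hF, hF, singleBoxField_zero]
      exact freeEnergy_singleBoxField_ge d hM hN hβ x b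
    have hsmooth : ContDiff ℝ 2 F := hF' ▸ contDiff_freeEnergy (isHermitian_hamiltonian d 0)
      (isHermitian_boxOp (isHermitian_spin3 d) x) β
    obtain ⟨h1, h2⟩ := iteratedDeriv_two_ge hmin
      (Filter.Eventually.of_forall fun b => hsmooth.differentiable two_ne_zero b)
      (hsmooth.differentiable_deriv_two 0)
    exact ⟨hmin, hsmooth.contDiffAt, by rw [h1, mul_zero], by linarith⟩
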